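/- **Theorem 4.1.** Consider $T$-round repeated bilateral trade. In round $t$ a fixed-price mechanism posts a (possibly randomized) pair of prices $(P^t,Q^t)\in[0,1]^2$, where $P^t$ is the seller's price and $Q^t$ the buyer's price, based on the prices and feedback of the earlier rounds (and on internal randomness independent of the values); the values $(S^t,B^t)$ of the seller and the buyer are drawn i.i.d. across rounds, independently of the internal randomness, from an unknown distribution $\mathcal D$. With $Z^t=\mathbf 1[S^t\le P^t]\cdot\mathbf 1[Q^t\le B^t]$, round $t$ yields gains from trade $(B^t-S^t)Z^t$ and profit $(Q^t-P^t)Z^t$, and then reveals *semi feedback*, which is of one fixed type among the four $$(S^t,\mathbf 1[Q^t\le B^t]),\qquad (\mathbf 1[S^t\le P^t],B^t),\qquad (S^t,Z^t),\qquad (Z^t,B^t).$$ Let $\mathfrak D$ be one of the following two families of distributions: (a) all product distributions $\mathcal D=\mathcal D_S\otimes\mathcal D_B$ on $[0,1]^2$ (independent values); (b) all those distributions in (a) that have a joint density bounded by $11$. The mechanism satisfies *Global Budget Balance* (GBB) if, for every $\mathcal D\in\mathfrak D$, $\sum_{t=1}^T (Q^t-P^t)Z^t\ge 0$ almost surely.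 Its worst-case regret is $$\sup_{\mathcal D\in\mathfrak D}\Big(\sup_{0\le p\le q\le 1}\mathbb E\Big[\sum_{t=1}^T (B^t-S^t)\mathbf 1[S^t\le p]\mathbf 1[q\le B^t]\Big]-\mathbb E\Big[\sum_{t=1}^T (B^t-S^t)Z^t\Big]\Big).$$ Then there are universal constants $c>0$ and $T_0$ such that, for all $T\ge T_0$, for each of the four types of semi feedback and for each of the two families $\mathfrak D$, every GBB fixed-price mechanism has worst-case regret at least $c\,T^{2/3}$. -/

import Mathlib

open MeasureTheory Set

namespace BilateralTrade

/-! Pairs of values are written `v = (S, B)` (seller, buyer) and pairs of prices `r = (P, Q)`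
(price for the seller, price for the buyer). -/

/-- The trade takes place iff the seller accepts `S ≤ P` and the buyer accepts `Q ≤ B`. -/
def Trades (v r : ℝ × ℝ) : Prop := v.1 ≤ r.1 ∧ r.2 ≤ v.2

noncomputable instance (v r : ℝ × ℝ) : Decidable (Trades v r) :=
  inferInstanceAs (Decidable (v.1 ≤ r.1 ∧ r.2 ≤ v.2))

/-- Gains from trade of one round. -/
noncomputable def gft (v r : ℝ × ℝ) : ℝ := if Trades v r then v.2 - v.1 else 0

/-- Profit of one round. -/
noncomputable def profit (v r : ℝ × ℝ) : ℝ := if Trades v r then r.2 - r.1 else 0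

/-- The four types of semi feedback: the value of one agent, together with either the other
agent's intention to trade or the trade outcome. -/
inductive SemiFeedback
  | sellerValueBuyerBit
  | sellerBitBuyerValue
  | sellerValueTrade
  | tradeBuyerValue

/-- What is revealed at the end of a round with values `v` and prices `r`. -/
noncomputable def SemiFeedback.reveal (F : SemiFeedback) (v r : ℝ × ℝ) : ℝ × Bool :=
  match F with
  | .sellerValueBuyerBit => (v.1, decide (r.2 ≤ v.2))
  | .sellerBitBuyerValue => (v.2, decide (v.1 ≤ r.1))
  | .sellerValueTrade => (v.1, decide (Trades v r))
  | .tradeBuyerValue => (v.2, decide (Trades v r))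

/-- The record of the first `t` rounds: posted prices and received feedback. -/
abbrev Record (t : ℕ) : Type := Fin t → (ℝ × ℝ) × (ℝ × Bool)

/-- A randomized `T`-round fixed-price mechanism with internal randomness in `Ω`: the pair of
prices in `[0, 1]²` posted in round `t` is a measurable function of the internal randomness and of
the prices and the feedback of the earlier rounds. -/
structure Mechanism (T : ℕ) (Ω : Type*) [MeasurableSpace Ω] where
  /-- the law of the internal randomness -/
  seed : Measure Ω
  seed_prob : IsProbabilityMeasure seed
  price : (t : Fin T) → Ω → Record t → ℝ × ℝ
  measurable_price : ∀ t : Fin T, Measurable fun x : Ω × Record t => price t x.1 x.2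
  price_mem : ∀ t ω h, price t ω h ∈ Icc (0 : ℝ) 1 ×ˢ Icc (0 : ℝ) 1

namespace Mechanism

variable {T : ℕ} {Ω : Type*} [MeasurableSpace Ω]

/-- The record of the first `t` rounds when the mechanism runs with randomness `ω` and feedback
type `F` on the value sequence `v`. -/
noncomputable def record (M : Mechanism T Ω) (F : SemiFeedback) (ω : Ω) (v : Fin T → ℝ × ℝ) :
    (t : ℕ) → t ≤ T → Record t
  | 0, _ => Fin.elim0
  | t + 1, h =>
      let past : Record t := M.record F ω v t (Nat.le_of_succ_le h)
      let r : ℝ × ℝ := M.price ⟨t, h⟩ ω past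
      Fin.snoc (α := fun _ => (ℝ × ℝ) × (ℝ × Bool)) past (r, F.reveal (v ⟨t, h⟩) r)

/-- The prices posted in round `t`. -/
noncomputable def posted (M : Mechanism T Ω) (F : SemiFeedback) (ω : Ω) (v : Fin T → ℝ × ℝ)
    (t : Fin T) : ℝ × ℝ :=
  M.price t ω (M.record F ω v t t.2.le)

/-- The joint law of the internal randomness and of the values, which are drawn i.i.d. from `D`,
independently of the internal randomness. -/
noncomputable def law (M : Mechanism T Ω) (D : Measure (ℝ × ℝ)) :
    Measure (Ω × (Fin T → ℝ × ℝ)) :=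
  M.seed.prod (Measure.pi fun _ => D)

/-- Expected total gains from trade of the mechanism. -/
noncomputable def totalGFT (M : Mechanism T Ω) (F : SemiFeedback) (D : Measure (ℝ × ℝ)) : ℝ :=
  ∫ x, ∑ t, gft (x.2 t) (M.posted F x.1 x.2 t) ∂(M.law D)

/-- Global Budget Balance over a family of value distributions: whichever of them generates the
values, the total profit over all rounds is nonnegative almost surely. -/
def IsGBB (M : Mechanism T Ω) (F : SemiFeedback) (𝒟 : Set (Measure (ℝ × ℝ))) : Prop :=
  ∀ D ∈ 𝒟, ∀ᵐ x ∂(M.law D), 0 ≤ ∑ t, profit (x.2 t) (M.posted F x.1 x.2 t)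

end Mechanism

/-- Bayesian-optimal total gains from trade: the best expected total gains from trade over `T`
rounds of fixed prices `0 ≤ p ≤ q ≤ 1`. -/
noncomputable def optGFT (T : ℕ) (D : Measure (ℝ × ℝ)) : ℝ :=
  sSup ((fun r : ℝ × ℝ => ∫ v : Fin T → ℝ × ℝ, ∑ t, gft (v t) r ∂(Measure.pi fun _ => D)) ''
    {r | 0 ≤ r.1 ∧ r.1 ≤ r.2 ∧ r.2 ≤ 1})

namespace Mechanism

variable {T : ℕ} {Ω : Type*} [MeasurableSpace Ω]

/-- Regret on a specific distribution of the values. -/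
noncomputable def regret (M : Mechanism T Ω) (F : SemiFeedback) (D : Measure (ℝ × ℝ)) : ℝ :=
  optGFT T D - M.totalGFT F D

/-- Worst-case regret over a family of value distributions. -/
noncomputable def worstRegret (M : Mechanism T Ω) (F : SemiFeedback)
    (𝒟 : Set (Measure (ℝ × ℝ))) : EReal :=
  ⨆ D ∈ 𝒟, (M.regret F D : EReal)

end Mechanism

/-- Independent values: product distributions supported on `[0, 1]²`. -/
def IndependentValues : Set (Measure (ℝ × ℝ)) :=
  {D | ∃ DS DB : Measure ℝ, IsProbabilityMeasure DS ∧ IsProbabilityMeasure DB ∧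
    DS (Icc 0 1)ᶜ = 0 ∧ DB (Icc 0 1)ᶜ = 0 ∧ D = DS.prod DB}

/-- Distributions with a joint density with respect to Lebesgue measure that is at most `K`. -/
def DensityBounded (K : NNReal) : Set (Measure (ℝ × ℝ)) :=
  {D | ∃ f : ℝ × ℝ → ENNReal, Measurable f ∧ (∀ x, f x ≤ K) ∧ D = volume.withDensity f}

end BilateralTrade

/-! The bound comes from two instances that are hard to tell apart. The seller's value is uniform on
the clusters `[0, 1/6]` and `[2/3, 5/6]`, the buyer's on `[1/6, 1/3]` and `[5/6, 1]`. Two fixed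
prices are optimal, each worth `1/4`: `1/6` (low sellers, all buyers) and `5/6` (all sellers, high
buyers). Accepting both low buyers and high sellers creates trades at a loss, so no pair in the
square, including `P > Q`, beats `1/4`.

Inside the lower buyer cluster, mass of order `η` is moved across `1/4`, upwards in one instance and
downwards in the other. This changes the value of the price `1/6` by `± η / 384` and leaves that of
`5/6` unchanged, so no single pair is good in both instances. The buyer's acceptance probability
depends on the sign only for `Q` in `(5/24, 7/24)`, where the gains from trade are lower by a
constant (`baseGFT_le_of_explore`). Learning the sign takes about `1 / η ^ 2` such rounds, not
learning it costs about `η * T`, and `η` of order `T ^ (-1/3)` balances the two at `T ^ (2/3)`.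

`HardPair` isolates what the argument needs, and `HardPair.le_regret_add` is the resulting bound on
the sum of the two regrets. Its proof follows the potential `L / (1 + L)`, where `L` is the
likelihood ratio of the record: its mean starts at `1/2` and drops by at most `16 * η ^ 2` times the
probability of exploring (`affinity_succ`). `hardPair_valueLaw` supplies the instances when the
seller's value is revealed. Reflecting the square, which exchanges seller and buyer, handles the
other two types of feedback (`HardPair.map_mirror`). -/

namespace BilateralTrade

/-! ### Measurability of one round, and resampling of one coordinate. -/

lemma measurableSet_trades :
    MeasurableSet {x : (ℝ × ℝ) × (ℝ × ℝ) | Trades x.1 x.2} := by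
  have h1 : MeasurableSet {x : (ℝ × ℝ) × (ℝ × ℝ) | x.1.1 ≤ x.2.1} :=
    measurableSet_le (by fun_prop) (by fun_prop)
  have h2 : MeasurableSet {x : (ℝ × ℝ) × (ℝ × ℝ) | x.2.2 ≤ x.1.2} :=
    measurableSet_le (by fun_prop) (by fun_prop)
  exact h1.inter h2

lemma measurable_decide {X : Type*} [MeasurableSpace X] {p : X → Prop} [DecidablePred p]
    (hp : MeasurableSet {x | p x}) : Measurable fun x => decide (p x) :=
  measurable_to_bool (by simpa [preimage] using hp)

lemma measurable_gft : Measurable fun x : (ℝ × ℝ) × (ℝ × ℝ) => gft x.1 x.2 :=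
  Measurable.ite measurableSet_trades (by fun_prop) measurable_const

lemma SemiFeedback.measurable_reveal (F : SemiFeedback) :
    Measurable fun x : (ℝ × ℝ) × (ℝ × ℝ) => F.reveal x.1 x.2 := by
  cases F
  · exact Measurable.prodMk (by fun_prop)
      (measurable_decide (measurableSet_le (by fun_prop) (by fun_prop)))
  · exact Measurable.prodMk (by fun_prop)
      (measurable_decide (measurableSet_le (by fun_prop) (by fun_prop)))
  · exact Measurable.prodMk (by fun_prop) (measurable_decide measurableSet_trades)
  · exact Measurable.prodMk (by fun_prop) (measurable_decide measurableSet_trades)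

lemma abs_gft_le_one {v r : ℝ × ℝ} (hv : v ∈ Icc (0 : ℝ) 1 ×ˢ Icc (0 : ℝ) 1) :
    |gft v r| ≤ 1 := by
  obtain ⟨⟨h1, h2⟩, h3, h4⟩ := hv
  unfold gft
  split_ifs
  · exact abs_le.2 ⟨by linarith, by linarith⟩
  · simp

/-- Resampling one coordinate preserves a product law. -/
lemma measurePreserving_update {T : ℕ} {X : Type*} [MeasurableSpace X] (D : Measure X)
    [IsProbabilityMeasure D] (t : Fin T) :
    MeasurePreserving (fun x : (Fin T → X) × X => Function.update x.1 t x.2)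
      ((Measure.pi fun _ => D).prod D) (Measure.pi fun _ => D) := by
  have hm : Measurable (fun x : (Fin T → X) × X => Function.update x.1 t x.2) := by
    refine measurable_pi_lambda _ fun i => ?_
    by_cases h : i = t
    · subst h; simpa using measurable_snd
    · simp only [Function.update_of_ne h]
      fun_prop
  refine ⟨hm, (Measure.pi_eq fun s hs => ?_).symm⟩
  rw [Measure.map_apply hm (MeasurableSet.univ_pi hs)]
  have : (fun x : (Fin T → X) × X => Function.update x.1 t x.2) ⁻¹' (univ.pi s)
      = (univ.pi (Function.update s t univ)) ×ˢ (s t) := by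
    ext ⟨v, w⟩
    simp only [mem_preimage, mem_pi, mem_univ, true_implies, mem_prod]
    constructor
    · intro h
      refine ⟨fun i => ?_, by simpa using h t⟩
      by_cases hi : i = t
      · subst hi; simp
      · simpa [hi] using h i
    · rintro ⟨h, hw⟩ i
      by_cases hi : i = t
      · subst hi; simpa using hw
      · simpa [hi] using h i
  rw [this, Measure.prod_prod, Measure.pi_pi, ← Finset.mul_prod_erase _ _ (Finset.mem_univ t),
    ← Finset.mul_prod_erase Finset.univ (fun i => D (s i)) (Finset.mem_univ t)]
  rw [Finset.prod_congr rfl (g := fun i => D (s i))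
    (fun i hi => by rw [Function.update_of_ne (Finset.ne_of_mem_erase hi)])]
  simp [mul_comm]

/-! ### Law of the record, and expected gains from trade as a sum over rounds. -/

namespace Mechanism
variable {T : ℕ} {Ω : Type*} [MeasurableSpace Ω] (M : Mechanism T Ω) (F : SemiFeedback)
  (D : Measure (ℝ × ℝ))

instance : IsProbabilityMeasure M.seed := M.seed_prob

instance [IsProbabilityMeasure D] : IsProbabilityMeasure (M.law D) := by
  unfold law; infer_instance

/-- One round: the record `h` is extended by the prices posted and the feedback on the values `w`. -/
noncomputable def extend (t : Fin T) (z : Ω × Record t) (w : ℝ × ℝ) : Record (t + 1) :=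
  Fin.snoc (α := fun _ => (ℝ × ℝ) × (ℝ × Bool)) z.2
    (M.price t z.1 z.2, F.reveal w (M.price t z.1 z.2))

lemma record_succ (ω : Ω) (v : Fin T → ℝ × ℝ) (t : Fin T) :
    M.record F ω v (t + 1) t.2 = M.extend F t (ω, M.record F ω v t t.2.le) (v t) := rfl

lemma measurable_extend (t : Fin T) :
    Measurable fun x : (Ω × Record t) × (ℝ × ℝ) => M.extend F t x.1 x.2 := by
  have hp : Measurable fun x : (Ω × Record t) × (ℝ × ℝ) => M.price t x.1.1 x.1.2 :=
    (M.measurable_price t).comp measurable_fst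
  refine measurable_pi_lambda _ fun i => ?_
  refine Fin.lastCases ?_ (fun i => ?_) i
  · simp only [extend, Fin.snoc_last]
    exact hp.prodMk (F.measurable_reveal.comp (measurable_snd.prodMk hp))
  · simp only [extend, Fin.snoc_castSucc]
    fun_prop

lemma measurable_record (t : ℕ) (ht : t ≤ T) :
    Measurable fun x : Ω × (Fin T → ℝ × ℝ) => M.record F x.1 x.2 t ht := by
  induction t with
  | zero => exact measurable_pi_lambda _ fun i => i.elim0
  | succ t ih =>
    exact (M.measurable_extend F ⟨t, ht⟩).comp
      ((measurable_fst.prodMk (ih (Nat.le_of_succ_le ht))).prodMk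
        ((measurable_pi_apply _).comp measurable_snd))

lemma record_congr (ω : Ω) {v v' : Fin T → ℝ × ℝ} (t : ℕ) (ht : t ≤ T)
    (h : ∀ i : Fin T, (i : ℕ) < t → v i = v' i) :
    M.record F ω v t ht = M.record F ω v' t ht := by
  induction t with
  | zero => rfl
  | succ t ih =>
    have e := ih (Nat.le_of_succ_le ht) fun i hi => h i (by omega)
    have := M.record_succ F ω v ⟨t, ht⟩
    have := M.record_succ F ω v' ⟨t, ht⟩
    simp only at *
    simp_all

/-- Internal randomness and record of the first `t` rounds. -/
noncomputable def hist (t : ℕ) (ht : t ≤ T) (x : Ω × (Fin T → ℝ × ℝ)) : Ω × Record t :=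
  (x.1, M.record F x.1 x.2 t ht)

lemma measurable_hist (t : ℕ) (ht : t ≤ T) : Measurable (M.hist F t ht) :=
  measurable_fst.prodMk (M.measurable_record F t ht)

/-- Law of the internal randomness and of the record of the first `t` rounds. -/
noncomputable def histLaw (t : ℕ) (ht : t ≤ T) : Measure (Ω × Record t) :=
  (M.law D).map (M.hist F t ht)

instance [IsProbabilityMeasure D] (t : ℕ) (ht : t ≤ T) :
    IsProbabilityMeasure (M.histLaw F D t ht) :=
  Measure.isProbabilityMeasure_map (M.measurable_hist F t ht).aemeasurable

/-- The values of round `t` are independent of the past. -/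
lemma map_hist_value [IsProbabilityMeasure D] (t : Fin T) :
    (M.law D).map (fun x => (M.hist F t t.2.le x, x.2 t))
      = (M.histLaw F D t t.2.le).prod D := by
  have h1 : MeasurePreserving (fun x : (Ω × (Fin T → ℝ × ℝ)) × (ℝ × ℝ) =>
      (x.1.1, Function.update x.1.2 t x.2)) ((M.law D).prod D) (M.law D) :=
    ((MeasurePreserving.id M.seed).prod (measurePreserving_update D t)).comp
      (measurePreserving_prodAssoc M.seed (Measure.pi fun _ => D) D)
  have hm : Measurable fun x : Ω × (Fin T → ℝ × ℝ) => (M.hist F t t.2.le x, x.2 t) :=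
    (M.measurable_hist F t t.2.le).prodMk ((measurable_pi_apply _).comp measurable_snd)
  have h2 := Measure.map_prod_map (M.law D) D (M.measurable_hist F t t.2.le) measurable_id
  rw [Measure.map_id] at h2
  rw [histLaw, h2]
  -- Resampling the values of round `t` preserves the law and cannot affect the earlier record, so
  -- the fresh sample plays the role of an independent copy.
  conv_lhs => rw [← h1.map_eq, Measure.map_map hm h1.measurable]
  congr 1
  funext x
  have : M.record F x.1.1 (Function.update x.1.2 t x.2) t t.2.le
      = M.record F x.1.1 x.1.2 t t.2.le :=
    M.record_congr F _ _ _ fun i hi =>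
      Function.update_of_ne (fun e => by subst e; exact lt_irrefl _ hi) _ _
  simp [hist, this, Prod.map]

lemma histLaw_succ [IsProbabilityMeasure D] (t : Fin T) :
    M.histLaw F D (t + 1) t.2
      = ((M.histLaw F D t t.2.le).prod D).map fun x => (x.1.1, M.extend F t x.1 x.2) := by
  have hm : Measurable fun x : Ω × (Fin T → ℝ × ℝ) => (M.hist F t t.2.le x, x.2 t) :=
    (M.measurable_hist F t t.2.le).prodMk ((measurable_pi_apply _).comp measurable_snd)
  have he : Measurable fun x : (Ω × Record t) × (ℝ × ℝ) => (x.1.1, M.extend F t x.1 x.2) :=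
    (measurable_fst.comp measurable_fst).prodMk (M.measurable_extend F t)
  rw [← M.map_hist_value F D t, Measure.map_map he hm]
  rfl

lemma integral_histLaw_succ [IsProbabilityMeasure D] (t : Fin T) {G : Ω × Record (t + 1) → ℝ}
    (hG : Measurable G) {C : ℝ} (hC : ∀ z, |G z| ≤ C) :
    ∫ z, G z ∂(M.histLaw F D (t + 1) t.2)
      = ∫ z, ∫ w, G (z.1, M.extend F t z w) ∂D ∂(M.histLaw F D t t.2.le) := by
  have hm : Measurable fun x : (Ω × Record t) × (ℝ × ℝ) => (x.1.1, M.extend F t x.1 x.2) :=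
    (measurable_fst.comp measurable_fst).prodMk (M.measurable_extend F t)
  rw [histLaw_succ, integral_map hm.aemeasurable hG.aestronglyMeasurable, integral_prod]
  exact Integrable.of_bound (hG.comp hm).aestronglyMeasurable C (ae_of_all _ fun x => hC _)

/-- Expected gains from trade of one round with prices `r`. -/
noncomputable def _root_.BilateralTrade.meanGFT (D : Measure (ℝ × ℝ)) (r : ℝ × ℝ) : ℝ :=
  ∫ v, gft v r ∂D

lemma _root_.BilateralTrade.measurable_meanGFT [IsProbabilityMeasure D] :
    Measurable (meanGFT D) := by
  have : StronglyMeasurable fun x : (ℝ × ℝ) × (ℝ × ℝ) => gft x.2 x.1 :=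
    (measurable_gft.comp measurable_swap).stronglyMeasurable
  exact this.integral_prod_right.measurable

lemma _root_.BilateralTrade.abs_meanGFT_le_one [IsProbabilityMeasure D]
    (hD : ∀ᵐ v ∂D, v ∈ Icc (0 : ℝ) 1 ×ˢ Icc (0 : ℝ) 1) (r : ℝ × ℝ) : |meanGFT D r| ≤ 1 := by
  have := norm_integral_le_of_norm_le_const (μ := D) (f := fun v => gft v r) (C := 1)
    (hD.mono fun v hv => abs_gft_le_one hv)
  simpa [meanGFT] using this

lemma totalGFT_eq [IsProbabilityMeasure D]
    (hD : ∀ᵐ v ∂D, v ∈ Icc (0 : ℝ) 1 ×ˢ Icc (0 : ℝ) 1) :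
    M.totalGFT F D
      = ∑ t : Fin T, ∫ z, meanGFT D (M.price t z.1 z.2) ∂(M.histLaw F D t t.2.le) := by
  have hm (t : Fin T) :
      Measurable fun x : Ω × (Fin T → ℝ × ℝ) => (M.hist F t t.2.le x, x.2 t) :=
    (M.measurable_hist F t t.2.le).prodMk ((measurable_pi_apply _).comp measurable_snd)
  have hg (t : Fin T) : Measurable fun y : (Ω × Record t) × (ℝ × ℝ) =>
      gft y.2 (M.price t y.1.1 y.1.2) :=
    measurable_gft.comp (measurable_snd.prodMk ((M.measurable_price t).comp measurable_fst))
  have hi (t : Fin T) : Integrable (fun y : (Ω × Record t) × (ℝ × ℝ) =>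
      gft y.2 (M.price t y.1.1 y.1.2)) ((M.histLaw F D t t.2.le).prod D) := by
    refine Integrable.of_bound (hg t).aestronglyMeasurable 1 ?_
    have : ∀ᵐ y ∂((M.histLaw F D t t.2.le).prod D), y.2 ∈ Icc (0 : ℝ) 1 ×ˢ Icc (0 : ℝ) 1 :=
      Measure.quasiMeasurePreserving_snd.ae hD
    exact this.mono fun y hy => abs_gft_le_one hy
  unfold totalGFT
  rw [integral_finsetSum]
  · refine Finset.sum_congr rfl fun t _ => ?_
    have e := integral_map (hm t).aemeasurable (μ := M.law D) (hg t).aestronglyMeasurable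
    rw [map_hist_value, integral_prod _ (hi t)] at e
    exact e.symm
  · intro t _
    have := (M.map_hist_value F D t ▸ hi t).comp_measurable (hm t)
    exact this

lemma _root_.BilateralTrade.le_optGFT [IsProbabilityMeasure D]
    (hD : ∀ᵐ v ∂D, v ∈ Icc (0 : ℝ) 1 ×ˢ Icc (0 : ℝ) 1) {r : ℝ × ℝ}
    (hr : 0 ≤ r.1 ∧ r.1 ≤ r.2 ∧ r.2 ≤ 1) : T * meanGFT D r ≤ optGFT T D := by
  have key (r : ℝ × ℝ) :
      ∫ v : Fin T → ℝ × ℝ, ∑ t, gft (v t) r ∂(Measure.pi fun _ => D) = T * meanGFT D r := by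
    have hg : Measurable fun v : ℝ × ℝ => gft v r :=
      measurable_gft.comp (measurable_id.prodMk measurable_const)
    have hi : Integrable (fun v => gft v r) D :=
      Integrable.of_bound hg.aestronglyMeasurable 1 (hD.mono fun v hv => abs_gft_le_one hv)
    have hp (t : Fin T) := measurePreserving_eval (fun _ : Fin T => D) t
    rw [integral_finsetSum]
    · have (t : Fin T) : ∫ v : Fin T → ℝ × ℝ, gft (v t) r ∂(Measure.pi fun _ => D)
          = meanGFT D r := by
        have e := integral_map (μ := Measure.pi fun _ : Fin T => D)
          (hp t).measurable.aemeasurable (hg.aestronglyMeasurable)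
        rw [(hp t).map_eq] at e
        exact e.symm
      simp [this]
    · intro t _
      exact (hp t).integrable_comp_of_integrable hi
  refine le_csSup ⟨T * 1, ?_⟩ ⟨r, hr, key r⟩
  rintro _ ⟨s, -, rfl⟩
  simp only [key]
  gcongr
  exact (abs_le.1 (abs_meanGFT_le_one D hD s)).2

end Mechanism
end BilateralTrade

/-! ### Regret bound for an abstract pair of instances. -/

namespace BilateralTrade

/-- Two value distributions with optimal gains from trade `V₀`, `V₁` per round. Prices in `E` are
costly under `D₀`, other prices do not help to tell `D₀` from `D₁` and cannot be good under both;
`ℓ` is the likelihood ratio of the prices and feedback of one round. -/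
structure HardPair (F : SemiFeedback) (D₀ D₁ : Measure (ℝ × ℝ)) (E : Set (ℝ × ℝ))
    (ℓ : (ℝ × ℝ) × (ℝ × Bool) → ℝ) (V₀ V₁ c η : ℝ) : Prop where
  prob₀ : IsProbabilityMeasure D₀
  prob₁ : IsProbabilityMeasure D₁
  supp₀ : ∀ᵐ v ∂D₀, v ∈ Icc (0 : ℝ) 1 ×ˢ Icc (0 : ℝ) 1
  supp₁ : ∀ᵐ v ∂D₁, v ∈ Icc (0 : ℝ) 1 ×ˢ Icc (0 : ℝ) 1
  measurable_explore : MeasurableSet E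
  measurable_ratio : Measurable ℓ
  ratio_off : ∀ y, y.1 ∉ E → ℓ y = 1
  ratio_close : ∀ y, |ℓ y - 1| ≤ 4 * η
  change : ∀ (r : ℝ × ℝ) (G : ℝ × Bool → ℝ), Measurable G → (∃ C, ∀ y, |G y| ≤ C) →
    ∫ w, G (F.reveal w r) ∂D₁ = ∫ w, ℓ (r, F.reveal w r) * G (F.reveal w r) ∂D₀
  attained₀ : ∃ r : ℝ × ℝ, (0 ≤ r.1 ∧ r.1 ≤ r.2 ∧ r.2 ≤ 1) ∧ meanGFT D₀ r = V₀
  attained₁ : ∃ r : ℝ × ℝ, (0 ≤ r.1 ∧ r.1 ≤ r.2 ∧ r.2 ≤ 1) ∧ meanGFT D₁ r = V₁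
  le₀ : ∀ r ∈ Icc (0 : ℝ) 1 ×ˢ Icc (0 : ℝ) 1, meanGFT D₀ r ≤ V₀
  le₁ : ∀ r ∈ Icc (0 : ℝ) 1 ×ˢ Icc (0 : ℝ) 1, meanGFT D₁ r ≤ V₁
  explore : ∀ r ∈ Icc (0 : ℝ) 1 ×ˢ Icc (0 : ℝ) 1, r ∈ E → meanGFT D₀ r ≤ V₀ - c
  exploit : ∀ r ∈ Icc (0 : ℝ) 1 ×ˢ Icc (0 : ℝ) 1, r ∉ E →
    meanGFT D₀ r + meanGFT D₁ r ≤ V₀ + V₁ - c * η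

/-- Likelihood ratio of a record. -/
noncomputable def likelihood (ℓ : (ℝ × ℝ) × (ℝ × Bool) → ℝ) {t : ℕ} (h : Record t) : ℝ :=
  ∏ i, ℓ (h i)

/-- The concave function `l ↦ a * l / (1 + a * l)` is compared with its tangent at `l = 1`. The
error is exactly `(l - 1) ^ 2` times a coefficient that is at most `1`. -/
lemma div_one_add_mul_ge {a l : ℝ} (ha : 0 ≤ a) (hl : 0 ≤ l) :
    a / (1 + a) + a / (1 + a) ^ 2 * (l - 1) - (l - 1) ^ 2 ≤ a * l / (1 + a * l) := by
  have h1 : 0 < 1 + a := by linarith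
  have h2 : 0 < 1 + a * l := by positivity
  have e : a * l / (1 + a * l) - (a / (1 + a) + a / (1 + a) ^ 2 * (l - 1))
      = - (a ^ 2 / ((1 + a) ^ 2 * (1 + a * l)) * (l - 1) ^ 2) := by
    field_simp
    ring
  have h3 : a ^ 2 / ((1 + a) ^ 2 * (1 + a * l)) ≤ 1 := by
    rw [div_le_one (by positivity)]
    nlinarith [mul_nonneg (sq_nonneg (1 + a)) (mul_nonneg ha hl)]
  nlinarith [mul_le_mul_of_nonneg_right h3 (sq_nonneg (l - 1))]

lemma abs_div_one_add_le {a : ℝ} (ha : 0 ≤ a) : |a / (1 + a)| ≤ 1 := by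
  rw [abs_of_nonneg (by positivity), div_le_one (by linarith)]
  linarith

namespace HardPair

variable {F : SemiFeedback} {D₀ D₁ : Measure (ℝ × ℝ)} {E : Set (ℝ × ℝ)}
    {ℓ : (ℝ × ℝ) × (ℝ × Bool) → ℝ} {V₀ V₁ c η : ℝ} (H : HardPair F D₀ D₁ E ℓ V₀ V₁ c η)
include H

lemma ratio_nonneg (hη : η ≤ 1 / 100) (y) : 0 ≤ ℓ y := by
  have := (abs_le.1 (H.ratio_close y)).1
  linarith

lemma ratio_le_two (hη : η ≤ 1 / 100) (y) : ℓ y ≤ 2 := by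
  have := (abs_le.1 (H.ratio_close y)).2
  linarith

lemma likelihood_nonneg (hη : η ≤ 1 / 100) {t : ℕ} (h : Record t) : 0 ≤ likelihood ℓ h :=
  Finset.prod_nonneg fun _ _ => H.ratio_nonneg hη _

lemma likelihood_le (hη : η ≤ 1 / 100) {t : ℕ} (h : Record t) : likelihood ℓ h ≤ 2 ^ t := by
  calc likelihood ℓ h ≤ ∏ _i : Fin t, (2 : ℝ) :=
        Finset.prod_le_prod (fun _ _ => H.ratio_nonneg hη _) fun _ _ => H.ratio_le_two hη _
    _ = 2 ^ t := by simp

lemma measurable_likelihood (t : ℕ) : Measurable fun h : Record t => likelihood ℓ h :=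
  Finset.measurable_prod _ fun i _ => H.measurable_ratio.comp (measurable_pi_apply i)

lemma integral_ratio (r : ℝ × ℝ) : ∫ w, ℓ (r, F.reveal w r) ∂D₀ = 1 := by
  have := H.prob₁
  simpa using (H.change r (fun _ => 1) measurable_const ⟨1, by simp⟩).symm

variable {T : ℕ} {Ω : Type*} [MeasurableSpace Ω] (M : Mechanism T Ω)

omit H in
lemma likelihood_extend (t : Fin T) (z : Ω × Record t) (w : ℝ × ℝ) :
    likelihood ℓ (M.extend F t z w)
      = likelihood ℓ z.2 * ℓ (M.price t z.1 z.2, F.reveal w (M.price t z.1 z.2)) := by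
  simp [likelihood, Mechanism.extend, Fin.prod_univ_castSucc]

omit H in
lemma histLaw_zero (D : Measure (ℝ × ℝ)) [IsProbabilityMeasure D] :
    M.histLaw F D 0 (Nat.zero_le T) = M.seed.map fun ω => (ω, Fin.elim0) := by
  have h : (M.law D).map Prod.fst = M.seed := by
    simp [Mechanism.law, Measure.map_fst_prod]
  have hm : Measurable fun ω : Ω => ((ω, Fin.elim0) : Ω × Record 0) :=
    measurable_id.prodMk measurable_const
  rw [← h, Measure.map_map hm measurable_fst]
  rfl

/-- Change of measure, by induction on the rounds: given the past, the prices are the same in both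
instances, so each round contributes only the ratio of its feedback. -/
lemma integral_histLaw_eq (hη : η ≤ 1 / 100) (t : ℕ) (ht : t ≤ T) {G : Ω × Record t → ℝ}
    (hG : Measurable G) {C : ℝ} (hC : ∀ z, |G z| ≤ C) :
    ∫ z, G z ∂(M.histLaw F D₁ t ht) = ∫ z, likelihood ℓ z.2 * G z ∂(M.histLaw F D₀ t ht) := by
  have := H.prob₀
  have := H.prob₁
  induction t generalizing C with
  | zero => simp [histLaw_zero, likelihood]
  | succ t ih =>
    have hm : Measurable fun x : (Ω × Record t) × (ℝ × ℝ) =>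
        (x.1.1, M.extend F ⟨t, ht⟩ x.1 x.2) :=
      (measurable_fst.comp measurable_fst).prodMk (M.measurable_extend F ⟨t, ht⟩)
    -- `0 ≤ C` needs a point of `Ω × Record (t + 1)`; `Ω` is nonempty because it carries a
    -- probability measure.
    have hC0 : 0 ≤ C := (abs_nonneg _).trans (hC
      (M.hist F (t + 1) ht (Classical.choice M.seed.nonempty_of_neZero, fun _ => 0)))
    rw [M.integral_histLaw_succ F D₁ ⟨t, ht⟩ hG hC, ih (Nat.le_of_succ_le ht)
      (G := fun z => ∫ w, G (z.1, M.extend F ⟨t, ht⟩ z w) ∂D₁) (C := C)]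
    · rw [M.integral_histLaw_succ F D₀ ⟨t, ht⟩ (G := fun z => likelihood ℓ z.2 * G z)
        (C := 2 ^ (t + 1) * C)]
      · congr 1
        funext z
        simp only [likelihood_extend]
        have e := H.change (M.price ⟨t, ht⟩ z.1 z.2)
          (fun y => G (z.1, Fin.snoc (α := fun _ => (ℝ × ℝ) × (ℝ × Bool)) z.2
            (M.price ⟨t, ht⟩ z.1 z.2, y))) ?_ ⟨C, fun y => hC _⟩
        · unfold Mechanism.extend
          rw [e, ← integral_const_mul]
          simp only [mul_assoc]
        · refine hG.comp (measurable_const.prodMk (measurable_pi_lambda _ fun i => ?_))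
          refine Fin.lastCases ?_ (fun i => ?_) i
          · simp only [Fin.snoc_last]; fun_prop
          · simp only [Fin.snoc_castSucc]; fun_prop
      · exact ((H.measurable_likelihood _).comp measurable_snd).mul hG
      · intro z
        rw [abs_mul, abs_of_nonneg (H.likelihood_nonneg hη _)]
        exact mul_le_mul (H.likelihood_le hη _) (hC z) (abs_nonneg _) (by positivity)
    · have hs : StronglyMeasurable fun x : (Ω × Record t) × (ℝ × ℝ) =>
          G (x.1.1, M.extend F ⟨t, ht⟩ x.1 x.2) := (hG.comp hm).stronglyMeasurable
      exact hs.integral_prod_right'.measurable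
    · intro z
      have := norm_integral_le_of_norm_le_const (μ := D₁)
        (f := fun w => G (z.1, M.extend F ⟨t, ht⟩ z w)) (C := C) (ae_of_all _ fun w => hC _)
      simpa using this

/-- Similarity of the two laws of the record. -/
noncomputable def affinity (_ : HardPair F D₀ D₁ E ℓ V₀ V₁ c η) (t : ℕ) (ht : t ≤ T) : ℝ :=
  ∫ z, likelihood ℓ z.2 / (1 + likelihood ℓ z.2) ∂(M.histLaw F D₀ t ht)

/-- Probability under `D₀` of posting prices in `E` in round `t`. -/
noncomputable def exploreProb (_ : HardPair F D₀ D₁ E ℓ V₀ V₁ c η) (t : Fin T) : ℝ :=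
  ∫ z, E.indicator 1 (M.price t z.1 z.2) ∂(M.histLaw F D₀ t t.2.le)

lemma measurable_indicator_price (t : Fin T) :
    Measurable fun z : Ω × Record t => E.indicator (1 : ℝ × ℝ → ℝ) (M.price t z.1 z.2) :=
  (measurable_one.indicator H.measurable_explore).comp (M.measurable_price t)

omit H in
lemma abs_indicator_one_le (r : ℝ × ℝ) : |E.indicator (1 : ℝ × ℝ → ℝ) r| ≤ 1 := by
  by_cases h : r ∈ E <;> simp [h]

lemma measurable_affinity_integrand (t : ℕ) : Measurable fun z : Ω × Record t =>
    likelihood ℓ z.2 / (1 + likelihood ℓ z.2) := by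
  have : Measurable fun z : Ω × Record t => likelihood ℓ z.2 :=
    (H.measurable_likelihood t).comp measurable_snd
  exact this.div (measurable_const.add this)

lemma affinity_zero : H.affinity M 0 (Nat.zero_le T) = 1 / 2 := by
  have := H.prob₀
  simp [affinity, likelihood]
  norm_num

/-- One round multiplies the likelihood by a ratio of conditional mean `1`, so the linear term of
`div_one_add_mul_ge` averages out. The quadratic term is at most `(4 * η) ^ 2`, and it vanishes
unless the prices explore. -/
lemma affinity_succ (hη : η ≤ 1 / 100) (t : Fin T) :
    H.affinity M t t.2.le - 16 * η ^ 2 * H.exploreProb M t ≤ H.affinity M (t + 1) t.2 := by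
  have := H.prob₀
  unfold affinity exploreProb
  rw [M.integral_histLaw_succ F D₀ t (H.measurable_affinity_integrand _)
    (fun z => abs_div_one_add_le (H.likelihood_nonneg hη _)), ← integral_const_mul,
    ← integral_sub]
  rotate_left
  · exact Integrable.of_bound (H.measurable_affinity_integrand _).aestronglyMeasurable 1
      (ae_of_all _ fun z => abs_div_one_add_le (H.likelihood_nonneg hη _))
  · exact (Integrable.of_bound (H.measurable_indicator_price M t).aestronglyMeasurable 1
      (ae_of_all _ fun z => abs_indicator_one_le _)).const_mul _
  have hm : Measurable fun x : (Ω × Record t) × (ℝ × ℝ) => (x.1.1, M.extend F t x.1 x.2) :=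
    (measurable_fst.comp measurable_fst).prodMk (M.measurable_extend F t)
  have hm2 := (H.measurable_affinity_integrand (Ω := Ω) (t + 1)).comp hm
  refine integral_mono ?_ ?_ fun z => ?_
  · refine Integrable.of_bound (C := 1 + |16 * η ^ 2|)
      ((H.measurable_affinity_integrand _).sub
        ((H.measurable_indicator_price M t).const_mul _)).aestronglyMeasurable
      (ae_of_all _ fun z => ?_)
    refine (norm_sub_le _ _).trans (add_le_add
      (abs_div_one_add_le (H.likelihood_nonneg hη _)) ?_)
    rw [norm_mul]
    exact mul_le_of_le_one_right (abs_nonneg _) (abs_indicator_one_le _)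
  · exact (Integrable.of_bound (μ := (M.histLaw F D₀ t t.2.le).prod D₀) hm2.aestronglyMeasurable 1
      (ae_of_all _ fun z => abs_div_one_add_le (H.likelihood_nonneg hη _))).integral_prod_left
  · set r := M.price t z.1 z.2 with hr
    set a := likelihood ℓ z.2
    have ha : 0 ≤ a := H.likelihood_nonneg hη _
    have hl : Integrable (fun w => ℓ (r, F.reveal w r)) D₀ := by
      refine Integrable.of_bound (C := 2) (Measurable.aestronglyMeasurable ?_)
        (ae_of_all _ fun w => ?_)
      · exact H.measurable_ratio.comp (measurable_const.prodMk
          (F.measurable_reveal.comp (measurable_id.prodMk measurable_const)))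
      · rw [Real.norm_eq_abs, abs_of_nonneg (H.ratio_nonneg hη _)]
        exact H.ratio_le_two hη _
    have e : ∫ w, (a / (1 + a) + a / (1 + a) ^ 2 * (ℓ (r, F.reveal w r) - 1)
        - 16 * η ^ 2 * E.indicator 1 r) ∂D₀ = a / (1 + a) - 16 * η ^ 2 * E.indicator 1 r := by
      have h1 : Integrable (fun w => a / (1 + a) ^ 2 * (ℓ (r, F.reveal w r) - 1)) D₀ :=
        (hl.sub (integrable_const 1)).const_mul _
      have h2 : Integrable (fun w => a / (1 + a)
          + a / (1 + a) ^ 2 * (ℓ (r, F.reveal w r) - 1)) D₀ := (integrable_const _).add h1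
      rw [integral_sub h2 (integrable_const _), integral_add (integrable_const _) h1, integral_const_mul,
        integral_sub hl (integrable_const _), H.integral_ratio]
      simp
    simp only [← e]
    refine integral_mono ?_ ?_ fun w => ?_
    · exact ((integrable_const _).add ((hl.sub (integrable_const 1)).const_mul _)).sub
        (integrable_const _)
    · exact Integrable.of_bound (hm2.comp measurable_prodMk_left).aestronglyMeasurable 1
        (ae_of_all _ fun w => abs_div_one_add_le (H.likelihood_nonneg hη _))
    · simp only [likelihood_extend]
      refine le_trans ?_ (div_one_add_mul_ge ha (H.ratio_nonneg hη _))
      refine sub_le_sub_left ?_ _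
      rw [← hr]
      by_cases hE : r ∈ E
      · have := H.ratio_close (r, F.reveal w r)
        rw [← sq_abs]
        simp only [hE, indicator_of_mem, Pi.one_apply]
        nlinarith [abs_nonneg (ℓ (r, F.reveal w r) - 1)]
      · simp [H.ratio_off (r, F.reveal w r) hE, hE]

/-- Telescoping of `affinity_succ`. Summing the exploration over the whole horizon makes the bound
the same for every `t`. -/
lemma affinity_ge (hη : η ≤ 1 / 100) (t : ℕ) (ht : t ≤ T) :
    1 / 2 - 16 * η ^ 2 * ∑ s, H.exploreProb M s ≤ H.affinity M t ht := by
  have hnn (s : Fin T) : 0 ≤ H.exploreProb M s :=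
    integral_nonneg fun z => indicator_nonneg (fun _ _ => zero_le_one) _
  have key : ∀ t (ht : t ≤ T), 1 / 2 - 16 * η ^ 2 *
      ∑ s : Fin t, H.exploreProb M (Fin.castLE ht s) ≤ H.affinity M t ht := by
    intro t
    induction t with
    | zero => intro ht; simp [H.affinity_zero M]
    | succ t ih =>
      intro ht
      have h1 := H.affinity_succ M hη ⟨t, ht⟩
      have h2 := ih (Nat.le_of_succ_le ht)
      rw [Fin.sum_univ_castSucc]
      have e : Fin.castLE ht (Fin.last t) = ⟨t, ht⟩ := rfl
      rw [e]
      have e2 : ∀ s : Fin t, Fin.castLE ht s.castSucc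
        = Fin.castLE (Nat.le_of_succ_le ht) s := fun s => rfl
      simp only [e2]
      linarith
  refine le_trans ?_ (key t ht)
  have : ∑ s : Fin t, H.exploreProb M (Fin.castLE ht s) ≤ ∑ s, H.exploreProb M s := by
    have e := Finset.sum_map Finset.univ (Fin.castLEEmb ht) (H.exploreProb M)
    simp only [Fin.coe_castLEEmb] at e
    rw [← e]
    exact Finset.sum_le_sum_of_subset_of_nonneg (Finset.subset_univ _) fun s _ _ => hnn s
  gcongr

omit H in
lemma _root_.BilateralTrade.Mechanism.le_regret (F : SemiFeedback) (D : Measure (ℝ × ℝ))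
    [IsProbabilityMeasure D] (hD : ∀ᵐ v ∂D, v ∈ Icc (0 : ℝ) 1 ×ˢ Icc (0 : ℝ) 1) {V : ℝ}
    (hV : ∃ r : ℝ × ℝ, (0 ≤ r.1 ∧ r.1 ≤ r.2 ∧ r.2 ≤ 1) ∧ meanGFT D r = V) :
    ∑ t : Fin T, ∫ z, (V - meanGFT D (M.price t z.1 z.2)) ∂(M.histLaw F D t t.2.le)
      ≤ M.regret F D := by
  obtain ⟨r, hr, rfl⟩ := hV
  have h := le_optGFT (T := T) D hD hr
  rw [Mechanism.regret, M.totalGFT_eq F D hD]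
  have e (t : Fin T) : ∫ z, (meanGFT D r - meanGFT D (M.price t z.1 z.2))
        ∂(M.histLaw F D t t.2.le)
      = meanGFT D r - ∫ z, meanGFT D (M.price t z.1 z.2) ∂(M.histLaw F D t t.2.le) := by
    rw [integral_sub (integrable_const _)]
    · simp
    · exact Integrable.of_bound ((measurable_meanGFT D).comp
        (M.measurable_price t)).aestronglyMeasurable 1
        (ae_of_all _ fun z => abs_meanGFT_le_one D hD _)
  simp only [e, Finset.sum_sub_distrib]
  simpa using h

/-- With `N` the expected number of exploring rounds under `D₀`, exploration costs `c * N`. The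
other rounds cost at least `c * η` times the affinity, which stays above `1 / 2 - 16 * η ^ 2 * N`.
Under `hT` the cost of exploring outweighs all that it can save. -/
theorem le_regret_add (hη0 : 0 ≤ η) (hη : η ≤ 1 / 100) (hc : 0 ≤ c)
    (hT : η + 16 * η ^ 3 * T ≤ 1) :
    c * η * T / 2 ≤ M.regret F D₀ + M.regret F D₁ := by
  have := H.prob₀
  have := H.prob₁
  have hnn (s : Fin T) : 0 ≤ H.exploreProb M s :=
    integral_nonneg fun z => indicator_nonneg (fun _ _ => zero_le_one) _
  -- Both losses are written under `D₀`, the second weighted by the likelihood `L`. As `L / (1 + L)`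
  -- is at most `1` and at most `L`, the weighted sum is at least `L / (1 + L)` times the sum of the
  -- losses, which is at least `c * η` outside `E`. Inside `E` the first loss alone is at least `c`.
  have hround (t : Fin T) : c * H.exploreProb M t
        + c * η * (H.affinity M t t.2.le - H.exploreProb M t)
      ≤ ∫ z, (V₀ - meanGFT D₀ (M.price t z.1 z.2)) ∂(M.histLaw F D₀ t t.2.le)
        + ∫ z, (V₁ - meanGFT D₁ (M.price t z.1 z.2)) ∂(M.histLaw F D₁ t t.2.le) := by
    have hm₀ : Measurable fun z : Ω × Record t => V₀ - meanGFT D₀ (M.price t z.1 z.2) :=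
      measurable_const.sub ((measurable_meanGFT D₀).comp (M.measurable_price t))
    have hm₁ : Measurable fun z : Ω × Record t => V₁ - meanGFT D₁ (M.price t z.1 z.2) :=
      measurable_const.sub ((measurable_meanGFT D₁).comp (M.measurable_price t))
    have hb₀ (z : Ω × Record t) : |V₀ - meanGFT D₀ (M.price t z.1 z.2)| ≤ |V₀| + 1 :=
      (abs_sub _ _).trans (add_le_add_right (abs_meanGFT_le_one D₀ H.supp₀ _) _)
    have hb₁ (z : Ω × Record t) : |V₁ - meanGFT D₁ (M.price t z.1 z.2)| ≤ |V₁| + 1 :=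
      (abs_sub _ _).trans (add_le_add_right (abs_meanGFT_le_one D₁ H.supp₁ _) _)
    have hi₀ := Integrable.of_bound (μ := M.histLaw F D₀ t t.2.le) hm₀.aestronglyMeasurable _
      (ae_of_all _ hb₀)
    have hi₁ : Integrable (fun z : Ω × Record t => likelihood ℓ z.2 *
        (V₁ - meanGFT D₁ (M.price t z.1 z.2))) (M.histLaw F D₀ t t.2.le) := by
      refine Integrable.of_bound (C := 2 ^ (t : ℕ) * (|V₁| + 1))
        (((H.measurable_likelihood t).comp measurable_snd).mul hm₁).aestronglyMeasurable
        (ae_of_all _ fun z => ?_)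
      rw [norm_mul, Real.norm_eq_abs, abs_of_nonneg (H.likelihood_nonneg hη _)]
      exact mul_le_mul (H.likelihood_le hη _) (hb₁ z) (abs_nonneg _) (by positivity)
    have hi₂ := Integrable.of_bound (μ := M.histLaw F D₀ t t.2.le)
      (H.measurable_indicator_price M t).aestronglyMeasurable 1
      (ae_of_all _ fun z => abs_indicator_one_le _)
    have hi₃ := Integrable.of_bound (μ := M.histLaw F D₀ t t.2.le)
      (H.measurable_affinity_integrand _).aestronglyMeasurable 1
      (ae_of_all _ fun z => abs_div_one_add_le (H.likelihood_nonneg hη _))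
    rw [H.integral_histLaw_eq M hη t t.2.le hm₁ hb₁, ← integral_add hi₀ hi₁]
    have hi₄ : Integrable (fun z : Ω × Record t => c * η * (likelihood ℓ z.2
        / (1 + likelihood ℓ z.2) - E.indicator 1 (M.price t z.1 z.2)))
        (M.histLaw F D₀ t t.2.le) := (hi₃.sub hi₂).const_mul _
    unfold exploreProb affinity
    rw [← integral_sub hi₃ hi₂, ← integral_const_mul, ← integral_const_mul,
      ← integral_add (hi₂.const_mul _) hi₄]
    refine integral_mono ((hi₂.const_mul _).add hi₄) (hi₀.add hi₁) fun z => ?_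
    have hp := M.price_mem t z.1 z.2
    have ha : 0 ≤ likelihood ℓ z.2 := H.likelihood_nonneg hη _
    set r := M.price t z.1 z.2
    set a := likelihood ℓ z.2
    have h0 := H.le₀ r hp
    have h1 := H.le₁ r hp
    have hφ1 : a / (1 + a) ≤ 1 := (le_abs_self _).trans (abs_div_one_add_le ha)
    have hφ0 : 0 ≤ a / (1 + a) := by positivity
    have hcη : 0 ≤ c * η := mul_nonneg hc hη0
    by_cases hE : r ∈ E
    · have := H.explore r hp hE
      simp only [hE, indicator_of_mem, Pi.one_apply]
      nlinarith [mul_nonneg hcη (sub_nonneg.2 hφ1), mul_nonneg ha (sub_nonneg.2 h1)]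
    · have := H.exploit r hp hE
      have hφa : a / (1 + a) ≤ a := div_le_self ha (by linarith)
      simp only [hE, not_false_eq_true, indicator_of_notMem]
      nlinarith [mul_nonneg (sub_nonneg.2 hφa) (sub_nonneg.2 h1),
        mul_nonneg (sub_nonneg.2 hφ1) (sub_nonneg.2 h0),
        mul_nonneg hφ0 (sub_nonneg.2 this)]
  have hsum := Finset.sum_le_sum fun t (_ : t ∈ Finset.univ) => hround t
  rw [Finset.sum_add_distrib, Finset.sum_add_distrib] at hsum
  have h₀ := M.le_regret F D₀ H.supp₀ H.attained₀
  have h₁ := M.le_regret F D₁ H.supp₁ H.attained₁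
  set N := ∑ s, H.exploreProb M s with hN
  have hN0 : 0 ≤ N := Finset.sum_nonneg fun s _ => hnn s
  have haff : T * (1 / 2 - 16 * η ^ 2 * N) ≤ ∑ t : Fin T, H.affinity M t t.2.le := by
    have := Finset.sum_le_sum fun t (_ : t ∈ (Finset.univ : Finset (Fin T))) =>
      H.affinity_ge M hη t t.2.le
    rwa [Finset.sum_const, Finset.card_univ, Fintype.card_fin, nsmul_eq_mul] at this
  rw [← Finset.mul_sum, ← Finset.mul_sum, Finset.sum_sub_distrib, ← hN] at hsum
  have hcη : 0 ≤ c * η := mul_nonneg hc hη0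
  have h3 := mul_le_mul_of_nonneg_left haff hcη
  have h4 : 0 ≤ c * N * (1 - (η + 16 * η ^ 3 * T)) :=
    mul_nonneg (mul_nonneg hc hN0) (by linarith)
  nlinarith

end HardPair
end BilateralTrade

/-! ### The two instances: densities and closed forms. -/

namespace BilateralTrade

/-- Projection of `x` to the interval `[a, b]`. -/
noncomputable def clamp (a b x : ℝ) : ℝ := max a (min b x)

/-- Clamping the threshold covers in one formula the cases where it lies left of, inside or right of
the interval. -/
lemma setIntegral_Icc_ite_le (a b p : ℝ) (g : ℝ → ℝ) :
    ∫ x in Icc a b, (if x ≤ p then g x else 0) = ∫ x in a..clamp a b p, g x := by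
  have h1 : (fun x => if x ≤ p then g x else 0) = (Iic p).indicator g := by
    funext x; simp [indicator]
  have h2 : Icc a b ∩ Iic p = Icc a (min b p) := by ext x; simp [and_assoc]
  rw [h1, setIntegral_indicator measurableSet_Iic, h2]
  unfold clamp
  rcases le_total a (min b p) with h | h
  · rw [max_eq_right h, integral_Icc_eq_integral_Ioc, intervalIntegral.integral_of_le h]
  · rw [max_eq_left h, intervalIntegral.integral_same, integral_Icc_eq_integral_Ioc,
      Ioc_eq_empty (not_lt.2 h)]
    simp

lemma setIntegral_Icc_ite_ge {a b : ℝ} (hab : a ≤ b) (q : ℝ) (g : ℝ → ℝ) :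
    ∫ x in Icc a b, (if q ≤ x then g x else 0) = ∫ x in clamp a b q..b, g x := by
  have h1 : (fun x => if q ≤ x then g x else 0) = (Ici q).indicator g := by
    funext x; simp [indicator]
  have h2 : Icc a b ∩ Ici q = Icc (max a q) b := by ext x; simp; tauto
  rw [h1, setIntegral_indicator measurableSet_Ici, h2]
  unfold clamp
  rcases le_total q b with h | h
  · rw [min_eq_right h, integral_Icc_eq_integral_Ioc,
      intervalIntegral.integral_of_le (max_le hab h)]
  · rw [min_eq_left h, max_eq_right hab, intervalIntegral.integral_same,
      integral_Icc_eq_integral_Ioc, Ioc_eq_empty (not_lt.2 (h.trans (le_max_right _ _)))]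
    simp

noncomputable section

/-- Indicator function of `[a, b]`. -/
def box (a b : ℝ) : ℝ → ℝ := (Icc a b).indicator 1

@[fun_prop]
lemma measurable_box (a b : ℝ) : Measurable (box a b) :=
  measurable_one.indicator measurableSet_Icc

lemma box_mul (a b : ℝ) (φ : ℝ → ℝ) : (fun x => box a b x * φ x) = (Icc a b).indicator φ := by
  funext x
  by_cases h : x ∈ Icc a b <;> simp [box, h]

/-- Density of the seller's value. -/
def sellerDensity (s : ℝ) : ℝ := 3 * box 0 (1 / 6) s + 3 * box (2 / 3) (5 / 6) s

/-- Density of the buyer's value, with a perturbation of size `η` around `1 / 4`. -/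
def buyerDensity (η b : ℝ) : ℝ := 3 * box (1 / 6) (1 / 3) b + 3 * box (5 / 6) 1 b
  + 3 * η * (box (1 / 4) (7 / 24) b - box (5 / 24) (1 / 4) b)

@[fun_prop]
lemma measurable_sellerDensity : Measurable sellerDensity := by
  unfold sellerDensity; fun_prop

@[fun_prop]
lemma measurable_buyerDensity (η : ℝ) : Measurable (buyerDensity η) := by
  unfold buyerDensity; fun_prop

lemma sellerDensity_mem (s : ℝ) : 0 ≤ sellerDensity s ∧ sellerDensity s ≤ 3 := by
  unfold sellerDensity box indicator
  simp only [mem_Icc, Pi.one_apply]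
  split_ifs <;> constructor <;> grind

lemma buyerDensity_mem {η : ℝ} (hη : |η| ≤ 1 / 100) (b : ℝ) :
    0 ≤ buyerDensity η b ∧ buyerDensity η b ≤ 7 / 2 := by
  have := abs_le.1 hη
  unfold buyerDensity box indicator
  simp only [mem_Icc, Pi.one_apply]
  split_ifs <;> constructor <;> grind

lemma sellerDensity_eq_zero {s : ℝ} (hs : s ∉ Icc (0 : ℝ) 1) : sellerDensity s = 0 := by
  unfold sellerDensity box indicator
  simp only [mem_Icc, Pi.one_apply] at *
  split_ifs <;> grind

lemma buyerDensity_eq_zero (η : ℝ) {b : ℝ} (hb : b ∉ Icc (0 : ℝ) 1) : buyerDensity η b = 0 := by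
  unfold buyerDensity box indicator
  simp only [mem_Icc, Pi.one_apply] at *
  split_ifs <;> grind

/-- Law of the seller's value. -/
def sellerLaw : Measure ℝ := volume.withDensity fun s => ENNReal.ofReal (sellerDensity s)

/-- Law of the buyer's value. -/
def buyerLaw (η : ℝ) : Measure ℝ := volume.withDensity fun b => ENNReal.ofReal (buyerDensity η b)

lemma integral_withDensity_ofReal {g : ℝ → ℝ} (hg : Measurable g) (h0 : ∀ x, 0 ≤ g x)
    (φ : ℝ → ℝ) :
    ∫ x, φ x ∂(volume.withDensity fun x => ENNReal.ofReal (g x)) = ∫ x, g x * φ x := by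
  rw [integral_withDensity_eq_integral_toReal_smul hg.ennreal_ofReal
    (ae_of_all _ fun _ => ENNReal.ofReal_lt_top)]
  simp [ENNReal.toReal_ofReal (h0 _)]

lemma integral_sellerLaw {φ : ℝ → ℝ} (hφ : ∀ a b, IntegrableOn φ (Icc a b)) :
    ∫ s, φ s ∂sellerLaw
      = 3 * (∫ s in Icc 0 (1 / 6), φ s) + 3 * ∫ s in Icc (2 / 3) (5 / 6), φ s := by
  have hi (a b : ℝ) : Integrable fun x => box a b x * φ x := by
    rw [box_mul]; exact (hφ a b).integrable_indicator measurableSet_Icc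
  have he (a b : ℝ) : ∫ x, box a b x * φ x = ∫ x in Icc a b, φ x := by
    rw [box_mul, integral_indicator measurableSet_Icc]
  rw [sellerLaw, integral_withDensity_ofReal measurable_sellerDensity
    fun s => (sellerDensity_mem s).1]
  simp only [sellerDensity, add_mul, mul_assoc]
  rw [integral_add ((hi _ _).const_mul _) ((hi _ _).const_mul _), integral_const_mul,
    integral_const_mul, he, he]

lemma integral_buyerLaw {η : ℝ} (hη : |η| ≤ 1 / 100) {φ : ℝ → ℝ}
    (hφ : ∀ a b, IntegrableOn φ (Icc a b)) :
    ∫ b, φ b ∂(buyerLaw η)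
      = 3 * (∫ b in Icc (1 / 6) (1 / 3), φ b) + 3 * (∫ b in Icc (5 / 6) 1, φ b)
        + 3 * η * ((∫ b in Icc (1 / 4) (7 / 24), φ b) - ∫ b in Icc (5 / 24) (1 / 4), φ b) := by
  have hi (a b : ℝ) : Integrable fun x => box a b x * φ x := by
    rw [box_mul]; exact (hφ a b).integrable_indicator measurableSet_Icc
  have he (a b : ℝ) : ∫ x, box a b x * φ x = ∫ x in Icc a b, φ x := by
    rw [box_mul, integral_indicator measurableSet_Icc]
  rw [buyerLaw, integral_withDensity_ofReal (measurable_buyerDensity η)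
    fun s => (buyerDensity_mem hη s).1]
  simp only [buyerDensity, add_mul, sub_mul, mul_assoc]
  have h1 := ((hi (1 / 6) (1 / 3)).const_mul 3).add ((hi (5 / 6) 1).const_mul 3)
  have h2 := (((hi (1 / 4) (7 / 24)).sub (hi (5 / 24) (1 / 4))).const_mul η).const_mul 3
  rw [integral_add (by exact h1) (by exact h2),
    integral_add ((hi _ _).const_mul _) ((hi _ _).const_mul _), integral_const_mul,
    integral_const_mul, integral_const_mul, integral_const_mul,
    integral_sub (hi _ _) (hi _ _), he, he, he, he]

lemma integrableOn_Icc_ite {g : ℝ → ℝ} (hg : Continuous g) (p : ℝ → Prop) [DecidablePred p]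
    (hp : MeasurableSet {x | p x}) (a b : ℝ) :
    IntegrableOn (fun x => if p x then g x else 0) (Icc a b) := by
  have : (fun x => if p x then g x else 0) = {x | p x}.indicator g := by
    funext x; simp [indicator]
  rw [this]
  exact (hg.integrableOn_Icc).indicator hp

lemma isProbabilityMeasure_withDensity_ofReal {g : ℝ → ℝ}
    (h : ∫ _, (1 : ℝ) ∂(volume.withDensity fun x => ENNReal.ofReal (g x)) = 1) :
    IsProbabilityMeasure (volume.withDensity fun x => ENNReal.ofReal (g x)) := by
  simp only [integral_const, smul_eq_mul, mul_one, Measure.real] at h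
  constructor
  exact (ENNReal.toReal_eq_one_iff _).1 h

instance : IsProbabilityMeasure sellerLaw := by
  refine isProbabilityMeasure_withDensity_ofReal ?_
  change ∫ _, (1 : ℝ) ∂sellerLaw = 1
  rw [integral_sellerLaw fun a b => continuous_const.integrableOn_Icc]
  norm_num

lemma isProbabilityMeasure_buyerLaw {η : ℝ} (hη : |η| ≤ 1 / 100) :
    IsProbabilityMeasure (buyerLaw η) := by
  refine isProbabilityMeasure_withDensity_ofReal ?_
  change ∫ _, (1 : ℝ) ∂(buyerLaw η) = 1
  rw [integral_buyerLaw hη fun a b => continuous_const.integrableOn_Icc]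
  norm_num

/-- Probability that the seller accepts the price `p`. -/
def sellerProb (p : ℝ) : ℝ := 3 * clamp 0 (1 / 6) p + 3 * (clamp (2 / 3) (5 / 6) p - 2 / 3)

/-- Expected cost of the seller on acceptance of `p`. -/
def sellerCost (p : ℝ) : ℝ :=
  3 * (clamp 0 (1 / 6) p ^ 2 / 2) + 3 * ((clamp (2 / 3) (5 / 6) p ^ 2 - (2 / 3) ^ 2) / 2)

/-- Probability that the buyer accepts the price `q`. -/
def buyerProb (η q : ℝ) : ℝ :=
  3 * (1 / 3 - clamp (1 / 6) (1 / 3) q) + 3 * (1 - clamp (5 / 6) 1 q)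
    + 3 * η * ((7 / 24 - clamp (1 / 4) (7 / 24) q) - (1 / 4 - clamp (5 / 24) (1 / 4) q))

/-- Expected gain of the buyer on acceptance of `q`. -/
def buyerGain (η q : ℝ) : ℝ :=
  3 * (((1 / 3) ^ 2 - clamp (1 / 6) (1 / 3) q ^ 2) / 2) + 3 * ((1 - clamp (5 / 6) 1 q ^ 2) / 2)
    + 3 * η * ((((7 / 24) ^ 2 - clamp (1 / 4) (7 / 24) q ^ 2) / 2)
      - (((1 / 4) ^ 2 - clamp (5 / 24) (1 / 4) q ^ 2) / 2))

lemma integral_sellerLaw_one (p : ℝ) :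
    ∫ s, (if s ≤ p then (1 : ℝ) else 0) ∂sellerLaw = sellerProb p := by
  rw [integral_sellerLaw (integrableOn_Icc_ite continuous_const _ measurableSet_Iic),
    setIntegral_Icc_ite_le, setIntegral_Icc_ite_le]
  simp [sellerProb]

lemma integral_sellerLaw_id (p : ℝ) :
    ∫ s, (if s ≤ p then s else 0) ∂sellerLaw = sellerCost p := by
  rw [integral_sellerLaw (integrableOn_Icc_ite continuous_id' _ measurableSet_Iic),
    setIntegral_Icc_ite_le, setIntegral_Icc_ite_le]
  simp [sellerCost, integral_id]

lemma integral_buyerLaw_one {η : ℝ} (hη : |η| ≤ 1 / 100) (q : ℝ) :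
    ∫ b, (if q ≤ b then (1 : ℝ) else 0) ∂(buyerLaw η) = buyerProb η q := by
  rw [integral_buyerLaw hη (integrableOn_Icc_ite continuous_const _ measurableSet_Ici),
    setIntegral_Icc_ite_ge (by norm_num), setIntegral_Icc_ite_ge (by norm_num),
    setIntegral_Icc_ite_ge (by norm_num), setIntegral_Icc_ite_ge (by norm_num)]
  simp [buyerProb]

lemma integral_buyerLaw_id {η : ℝ} (hη : |η| ≤ 1 / 100) (q : ℝ) :
    ∫ b, (if q ≤ b then b else 0) ∂(buyerLaw η) = buyerGain η q := by
  rw [integral_buyerLaw hη (integrableOn_Icc_ite continuous_id' _ measurableSet_Ici),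
    setIntegral_Icc_ite_ge (by norm_num), setIntegral_Icc_ite_ge (by norm_num),
    setIntegral_Icc_ite_ge (by norm_num), setIntegral_Icc_ite_ge (by norm_num)]
  simp [buyerGain, integral_id]

/-- Joint law of the values. -/
def valueLaw (η : ℝ) : Measure (ℝ × ℝ) := sellerLaw.prod (buyerLaw η)

lemma valueLaw_eq_withDensity (η : ℝ) : valueLaw η = volume.withDensity
    fun v => ENNReal.ofReal (sellerDensity v.1) * ENNReal.ofReal (buyerDensity η v.2) := by
  rw [valueLaw, sellerLaw, buyerLaw, prod_withDensity (by fun_prop) (by fun_prop)]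
  rfl

lemma sellerLaw_compl : sellerLaw (Icc 0 1)ᶜ = 0 := by
  rw [sellerLaw, withDensity_apply _ measurableSet_Icc.compl,
    setLIntegral_congr_fun (g := 0) measurableSet_Icc.compl
      fun s hs => by simp [sellerDensity_eq_zero hs]]
  simp

lemma buyerLaw_compl (η : ℝ) : buyerLaw η (Icc 0 1)ᶜ = 0 := by
  rw [buyerLaw, withDensity_apply _ measurableSet_Icc.compl,
    setLIntegral_congr_fun (g := 0) measurableSet_Icc.compl
      fun s hs => by simp [buyerDensity_eq_zero η hs]]
  simp

/-- The joint density is at most `3 * (7 / 2) = 21 / 2`, which is below `11`. -/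
lemma valueLaw_mem {η : ℝ} (hη : |η| ≤ 1 / 100) :
    valueLaw η ∈ IndependentValues ∩ DensityBounded 11 := by
  have := isProbabilityMeasure_buyerLaw hη
  refine ⟨⟨sellerLaw, buyerLaw η, inferInstance, this, sellerLaw_compl, buyerLaw_compl η, rfl⟩,
    _, by fun_prop, fun v => ?_, valueLaw_eq_withDensity η⟩
  have h1 := sellerDensity_mem v.1
  have h2 := buyerDensity_mem hη v.2
  rw [← ENNReal.ofReal_mul h1.1]
  refine ENNReal.ofReal_le_of_le_toReal ?_
  simp only [ENNReal.coe_toReal]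
  push_cast
  nlinarith

lemma IndependentValues.ae_mem {D : Measure (ℝ × ℝ)} (hD : D ∈ IndependentValues) :
    ∀ᵐ v ∂D, v ∈ Icc (0 : ℝ) 1 ×ˢ Icc (0 : ℝ) 1 := by
  obtain ⟨S, B, hS, hB, hS0, hB0, rfl⟩ := hD
  have h1 : ∀ᵐ v ∂(S.prod B), v.1 ∈ Icc (0 : ℝ) 1 :=
    Measure.quasiMeasurePreserving_fst.ae hS0
  have h2 : ∀ᵐ v ∂(S.prod B), v.2 ∈ Icc (0 : ℝ) 1 :=
    Measure.quasiMeasurePreserving_snd.ae hB0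
  filter_upwards [h1, h2] with v a b using ⟨a, b⟩

lemma meanGFT_valueLaw {η : ℝ} (hη : |η| ≤ 1 / 100) (r : ℝ × ℝ) :
    meanGFT (valueLaw η) r
      = sellerProb r.1 * buyerGain η r.2 - sellerCost r.1 * buyerProb η r.2 := by
  have := isProbabilityMeasure_buyerLaw hη
  have e (v : ℝ × ℝ) : gft v r
      = (if v.1 ≤ r.1 then (1 : ℝ) else 0) * (if r.2 ≤ v.2 then v.2 else 0)
        - (if v.1 ≤ r.1 then v.1 else 0) * (if r.2 ≤ v.2 then (1 : ℝ) else 0) := by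
    unfold gft Trades
    by_cases h1 : v.1 ≤ r.1 <;> by_cases h2 : r.2 ≤ v.2 <;> simp [h1, h2]
  have hsupp := IndependentValues.ae_mem (valueLaw_mem hη).1
  have hP : IsProbabilityMeasure (valueLaw η) := by unfold valueLaw; infer_instance
  have hm1 : MeasurableSet {v : ℝ × ℝ | v.1 ≤ r.1} :=
    measurableSet_le measurable_fst measurable_const
  have hm2 : MeasurableSet {v : ℝ × ℝ | r.2 ≤ v.2} :=
    measurableSet_le measurable_const measurable_snd
  have hi1 : Integrable (fun v : ℝ × ℝ => (if v.1 ≤ r.1 then (1 : ℝ) else 0)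
      * (if r.2 ≤ v.2 then v.2 else 0)) (valueLaw η) := by
    refine Integrable.of_bound ((Measurable.ite hm1 measurable_const measurable_const).mul
      (Measurable.ite hm2 measurable_snd measurable_const)).aestronglyMeasurable 1
      (hsupp.mono fun v hv => ?_)
    obtain ⟨⟨a, b⟩, c, d⟩ := hv
    split_ifs <;> simp [abs_le]
    constructor <;> linarith
  have hi2 : Integrable (fun v : ℝ × ℝ => (if v.1 ≤ r.1 then v.1 else 0)
      * (if r.2 ≤ v.2 then (1 : ℝ) else 0)) (valueLaw η) := by
    refine Integrable.of_bound ((Measurable.ite hm1 measurable_fst measurable_const).mul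
      (Measurable.ite hm2 measurable_const measurable_const)).aestronglyMeasurable 1
      (hsupp.mono fun v hv => ?_)
    obtain ⟨⟨a, b⟩, c, d⟩ := hv
    split_ifs <;> simp [abs_le]
    constructor <;> linarith
  simp only [meanGFT, e]
  rw [integral_sub hi1 hi2]
  unfold valueLaw
  rw [integral_prod_mul (fun s => if s ≤ r.1 then (1 : ℝ) else 0)
      (fun b => if r.2 ≤ b then b else 0),
    integral_prod_mul (fun s => if s ≤ r.1 then s else 0)
      (fun b => if r.2 ≤ b then (1 : ℝ) else 0), integral_sellerLaw_one, integral_sellerLaw_id,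
    integral_buyerLaw_one hη, integral_buyerLaw_id hη]

/-- The seller's value and the buyer's bit are independent, so `η` enters the law of the feedback
only through the acceptance probability. -/
lemma integral_reveal_valueLaw {η : ℝ} (hη : |η| ≤ 1 / 100) (q : ℝ) {G : ℝ × Bool → ℝ}
    (hG : Measurable G) {C : ℝ} (hC : ∀ y, |G y| ≤ C) :
    ∫ w, G (w.1, decide (q ≤ w.2)) ∂(valueLaw η)
      = buyerProb η q * (∫ s, G (s, true) ∂sellerLaw)
        + (1 - buyerProb η q) * ∫ s, G (s, false) ∂sellerLaw := by
  have := isProbabilityMeasure_buyerLaw hη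
  have hi (x : Bool) : Integrable (fun s => G (s, x)) sellerLaw :=
    Integrable.of_bound (hG.comp measurable_prodMk_right).aestronglyMeasurable C
      (ae_of_all _ fun _ => hC _)
  have hm : Measurable fun w : ℝ × ℝ => G (w.1, decide (q ≤ w.2)) :=
    hG.comp (measurable_fst.prodMk (measurable_decide
      (measurableSet_le measurable_const measurable_snd)))
  have hb : Integrable (fun b => if q ≤ b then (1 : ℝ) else 0) (buyerLaw η) :=
    Integrable.of_bound (Measurable.ite measurableSet_Ici measurable_const
      measurable_const).aestronglyMeasurable 1 (ae_of_all _ fun b => by split_ifs <;> simp)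
  rw [valueLaw, integral_prod _ (Integrable.of_bound hm.aestronglyMeasurable C
    (ae_of_all _ fun _ => hC _))]
  have e (s : ℝ) : ∫ b, G (s, decide (q ≤ b)) ∂(buyerLaw η)
      = buyerProb η q * G (s, true) + (1 - buyerProb η q) * G (s, false) := by
    have e1 (b : ℝ) : G (s, decide (q ≤ b))
        = (if q ≤ b then (1 : ℝ) else 0) * (G (s, true) - G (s, false)) + G (s, false) := by
      by_cases h : q ≤ b <;> simp [h]
    simp only [e1]
    rw [integral_add (hb.mul_const _) (integrable_const _), integral_mul_const,
      integral_buyerLaw_one hη]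
    simp
    ring
  simp only [e]
  rw [integral_add ((hi _).const_mul _) ((hi _).const_mul _), integral_const_mul,
    integral_const_mul]

end
end BilateralTrade

/-! ### Gains from trade and information in the two instances. -/

namespace BilateralTrade
noncomputable section

lemma clamp_mem {a b : ℝ} (hab : a ≤ b) (x : ℝ) : a ≤ clamp a b x ∧ clamp a b x ≤ b :=
  ⟨le_max_left _ _, max_le hab (min_le_left _ _)⟩

lemma clamp_of_le {a b x : ℝ} (h : x ≤ a) : clamp a b x = a :=
  max_eq_left ((min_le_right _ _).trans h)

lemma clamp_of_ge {a b x : ℝ} (hab : a ≤ b) (h : b ≤ x) : clamp a b x = b := by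
  rw [clamp, min_eq_left h, max_eq_right hab]

lemma clamp_of_mem {a b x : ℝ} (ha : a ≤ x) (hb : x ≤ b) : clamp a b x = x := by
  rw [clamp, min_eq_right hb, max_eq_right ha]

/-- Change of the buyer's acceptance probability per unit of perturbation. -/
def probShift (q : ℝ) : ℝ :=
  3 * ((7 / 24 - clamp (1 / 4) (7 / 24) q) - (1 / 4 - clamp (5 / 24) (1 / 4) q))

/-- Change of the buyer's expected gain per unit of perturbation. -/
def gainShift (q : ℝ) : ℝ :=
  3 * ((((7 / 24) ^ 2 - clamp (1 / 4) (7 / 24) q ^ 2) / 2)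
      - (((1 / 4) ^ 2 - clamp (5 / 24) (1 / 4) q ^ 2) / 2))

lemma buyerProb_eq (η q : ℝ) : buyerProb η q = buyerProb 0 q + η * probShift q := by
  unfold buyerProb probShift; ring

lemma buyerGain_eq (η q : ℝ) : buyerGain η q = buyerGain 0 q + η * gainShift q := by
  unfold buyerGain gainShift; ring

/-- Such a price accepts both perturbed intervals: a mass `1/8` per unit of `η` has moved up by
`1/24`, so the mean changes while the acceptance probability does not. -/
lemma shift_of_le {q : ℝ} (hq : q ≤ 5 / 24) : probShift q = 0 ∧ gainShift q = 1 / 192 := by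
  unfold probShift gainShift
  rw [clamp_of_le (by linarith), clamp_of_le hq]
  norm_num

lemma shift_of_ge {q : ℝ} (hq : 7 / 24 ≤ q) : probShift q = 0 ∧ gainShift q = 0 := by
  unfold probShift gainShift
  rw [clamp_of_ge (by norm_num) hq, clamp_of_ge (by norm_num) (by linarith)]
  norm_num

lemma shift_mem (q : ℝ) :
    (0 ≤ probShift q ∧ probShift q ≤ 1 / 8) ∧ 0 ≤ gainShift q ∧ gainShift q ≤ 1 / 8 := by
  rcases le_total q (5 / 24) with h1 | h1
  · rw [(shift_of_le h1).1, (shift_of_le h1).2]; norm_num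
  rcases le_total (7 / 24) q with h2 | h2
  · rw [(shift_of_ge h2).1, (shift_of_ge h2).2]; norm_num
  unfold probShift gainShift
  rcases le_total q (1 / 4) with h | h
  · rw [clamp_of_le h, clamp_of_mem h1 h]
    refine ⟨⟨?_, ?_⟩, ?_, ?_⟩ <;> nlinarith
  · rw [clamp_of_mem h h2, clamp_of_ge (by norm_num) h]
    refine ⟨⟨?_, ?_⟩, ?_, ?_⟩ <;> nlinarith

/-- Normal form of the seller's side: `u` and `x` are the masses of accepting sellers in the two
clusters. -/
lemma seller_cases (p : ℝ) : ∃ u x : ℝ, (0 ≤ u ∧ u ≤ 1 / 2) ∧ (0 ≤ x ∧ x ≤ 1 / 2) ∧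
    (x = 0 ∨ u = 1 / 2) ∧ sellerProb p = u + x ∧
    sellerCost p = u ^ 2 / 6 + x ^ 2 / 6 + 2 * x / 3 := by
  have h1 := clamp_mem (show (0 : ℝ) ≤ 1 / 6 by norm_num) p
  have h2 := clamp_mem (show (2 / 3 : ℝ) ≤ 5 / 6 by norm_num) p
  refine ⟨3 * clamp 0 (1 / 6) p, 3 * clamp (2 / 3) (5 / 6) p - 2, ⟨?_, ?_⟩, ⟨?_, ?_⟩, ?_, ?_, ?_⟩
  · linarith
  · linarith
  · linarith
  · linarith
  · rcases le_total p (2 / 3) with h | h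
    · left; rw [clamp_of_le h]; norm_num
    · right; rw [clamp_of_ge (by norm_num) (by linarith)]; norm_num
  · unfold sellerProb; ring
  · unfold sellerCost; ring

/-- Normal form of the buyer's side: `w` and `y` are the masses of accepting buyers in the two
clusters. -/
lemma buyer_cases (q : ℝ) : ∃ w y : ℝ, (0 ≤ w ∧ w ≤ 1 / 2) ∧ (0 ≤ y ∧ y ≤ 1 / 2) ∧
    (y = 0 ∨ w = 1 / 2) ∧ buyerProb 0 q = w + y ∧
    buyerGain 0 q = w - w ^ 2 / 6 + y / 3 - y ^ 2 / 6 ∧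
    (q ≤ 5 / 24 → 3 / 8 ≤ y) ∧ (5 / 24 ≤ q → q ≤ 7 / 24 → 1 / 8 ≤ y ∧ y ≤ 3 / 8) := by
  have h1 := clamp_mem (show (1 / 6 : ℝ) ≤ 1 / 3 by norm_num) q
  have h2 := clamp_mem (show (5 / 6 : ℝ) ≤ 1 by norm_num) q
  refine ⟨3 - 3 * clamp (5 / 6) 1 q, 1 - 3 * clamp (1 / 6) (1 / 3) q, ⟨?_, ?_⟩, ⟨?_, ?_⟩, ?_, ?_,
    ?_, ?_, ?_⟩
  · linarith
  · linarith
  · linarith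
  · linarith
  · rcases le_total q (5 / 6) with h | h
    · right; rw [clamp_of_le h]; norm_num
    · left; rw [clamp_of_ge (by norm_num) (by linarith)]; norm_num
  · unfold buyerProb; ring
  · unfold buyerGain; ring
  · intro h
    have : clamp (1 / 6) (1 / 3) q ≤ 5 / 24 :=
      max_le (by norm_num) ((min_le_right _ _).trans h)
    linarith
  · intro h h'
    rw [clamp_of_mem (by linarith) (by linarith)]
    constructor <;> linarith

lemma sellerProb_le (p : ℝ) : 0 ≤ sellerProb p ∧ sellerProb p ≤ 1 := by
  obtain ⟨u, x, ⟨a, b⟩, ⟨c, d⟩, -, h, -⟩ := seller_cases p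
  rw [h]; constructor <;> linarith

lemma sellerCost_le (p : ℝ) : 0 ≤ sellerCost p ∧ sellerCost p ≤ 1 := by
  obtain ⟨u, x, ⟨a, b⟩, ⟨c, d⟩, -, -, h⟩ := seller_cases p
  rw [h]; constructor <;> nlinarith

/-- Gains from trade per round of the unperturbed instance. -/
def baseGFT (p q : ℝ) : ℝ := sellerProb p * buyerGain 0 q - sellerCost p * buyerProb 0 q

/-- When an agent accepts only part of its better cluster, accepting more of it helps or the number
of trades is too small anyway. Once both better clusters are full, the gains are `5/24` plus a
polynomial in `x, y`, whose negative mixed terms come from trades between high sellers and low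
buyers; it is at most `1/24`. -/
lemma baseGFT_le (p q : ℝ) : baseGFT p q ≤ 1 / 4 := by
  obtain ⟨u, x, ⟨u0, u1⟩, ⟨x0, x1⟩, hx, hF, hA⟩ := seller_cases p
  obtain ⟨w, y, ⟨w0, w1⟩, ⟨y0, y1⟩, hy, hG, hC, -, -⟩ := buyer_cases q
  rw [baseGFT, hF, hA, hG, hC]
  rcases hx with rfl | rfl <;> rcases hy with rfl | rfl
  · have : u * w ≤ 1 / 4 := by nlinarith
    nlinarith [mul_nonneg u0 w0, mul_nonneg (mul_nonneg u0 w0) u0,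
      mul_nonneg (mul_nonneg u0 w0) w0]
  · have h1 : u * (1 / 2 - 1 / 24 + y / 3 - y ^ 2 / 6 - u / 6 * (1 / 2 + y)) ≤ 1 / 4 := by
      -- This is the slope of the secant in `u` between `u` and `1 / 2`; its sign reduces the claim
      -- to `u = 1 / 2`.
      have h2 : 0 ≤ 1 / 2 - 1 / 24 + y / 3 - y ^ 2 / 6 - (1 / 2 + u) / 6 * (1 / 2 + y) := by
        nlinarith
      nlinarith [mul_nonneg (sub_nonneg.2 u1) h2]
    nlinarith
  · have h1 : w * (1 / 2 - 1 / 24 + x / 3 - x ^ 2 / 6 - w / 6 * (1 / 2 + x)) ≤ 1 / 4 := by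
      have h2 : 0 ≤ 1 / 2 - 1 / 24 + x / 3 - x ^ 2 / 6 - (1 / 2 + w) / 6 * (1 / 2 + x) := by
        nlinarith
      nlinarith [mul_nonneg (sub_nonneg.2 w1) h2]
    nlinarith
  · nlinarith [mul_nonneg x0 y0, mul_nonneg (mul_nonneg x0 y0) x0,
      mul_nonneg (mul_nonneg x0 y0) y0, mul_nonneg (sub_nonneg.2 x1) (sub_nonneg.2 y1),
      mul_nonneg x0 (sub_nonneg.2 y1), mul_nonneg (sub_nonneg.2 x1) y0]

/-- Here the buyer accepts between a quarter and three quarters of the low cluster (`1/8 ≤ y ≤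
3/8`). This stays away from both optima, which have `y = 1/2` and `y = 0`. -/
lemma baseGFT_le_of_explore {p q : ℝ} (h1 : 5 / 24 ≤ q) (h2 : q ≤ 7 / 24) :
    baseGFT p q ≤ 1 / 4 - 1 / 200 := by
  obtain ⟨u, x, ⟨u0, u1⟩, ⟨x0, x1⟩, hx, hF, hA⟩ := seller_cases p
  obtain ⟨w, y, ⟨w0, w1⟩, ⟨y0, y1⟩, hy, hG, hC, -, hq⟩ := buyer_cases q
  obtain ⟨y2, y3⟩ := hq h1 h2
  rw [baseGFT, hF, hA, hG, hC]
  obtain rfl : w = 1 / 2 := by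
    rcases hy with h | h
    · linarith
    · exact h
  rcases hx with rfl | rfl
  · have h2 : 0 ≤ 1 / 2 - 1 / 24 + y / 3 - y ^ 2 / 6 - (1 / 2 + u) / 6 * (1 / 2 + y) := by
      nlinarith
    nlinarith [mul_nonneg (sub_nonneg.2 u1) h2]
  · have e1 : y / 8 - y ^ 2 / 12 + x / 8 - x ^ 2 / 12 - x * y / 3 - x * y * (x + y) / 6
        ≤ 1 / 24 - 1 / 200 := by
      have hxy := mul_nonneg x0 (sub_nonneg.2 y2)
      nlinarith [mul_nonneg x0 y0, mul_nonneg (mul_nonneg x0 y0) x0,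
        mul_nonneg (mul_nonneg x0 y0) y0, mul_nonneg (sub_nonneg.2 x1) (sub_nonneg.2 y3),
        mul_nonneg x0 (sub_nonneg.2 y3), mul_nonneg (sub_nonneg.2 x1) (sub_nonneg.2 y2),
        mul_nonneg (sub_nonneg.2 y2) (sub_nonneg.2 y3), sq_nonneg (x - 1 / 8),
        mul_nonneg hxy x0, mul_nonneg hxy (sub_nonneg.2 y3)]
    nlinarith

/-- When most low buyers accept, admitting high sellers lowers the gains at a linear rate. This
prevents the mechanism from amplifying the perturbation by raising the seller's acceptance
probability above `1 / 2`. -/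
lemma baseGFT_le_of_le {p q : ℝ} (h1 : q ≤ 5 / 24) :
    baseGFT p q ≤ 1 / 4 - 1 / 100 * (sellerProb p - 1 / 2) := by
  have h0 := baseGFT_le p q
  obtain ⟨u, x, ⟨u0, u1⟩, ⟨x0, x1⟩, hx, hF, hA⟩ := seller_cases p
  obtain ⟨w, y, ⟨w0, w1⟩, ⟨y0, y1⟩, hy, hG, hC, hq, -⟩ := buyer_cases q
  have y2 := hq h1
  rcases hx with rfl | rfl
  · rw [hF]; linarith
  obtain rfl : w = 1 / 2 := by
    rcases hy with h | h
    · linarith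
    · exact h
  rw [baseGFT, hF, hA, hG, hC]
  have e1 : y / 8 - y ^ 2 / 12 ≤ 1 / 24 := by nlinarith
  have e2 : x * (1 / 8 - y / 3 - y ^ 2 / 6) ≤ - (1 / 100) * x := by nlinarith
  nlinarith [mul_nonneg (mul_nonneg x0 x0) y0, mul_nonneg x0 x0]

lemma meanGFT_valueLaw_eq {η : ℝ} (hη : |η| ≤ 1 / 100) (r : ℝ × ℝ) :
    meanGFT (valueLaw η) r = baseGFT r.1 r.2
      + η * (sellerProb r.1 * gainShift r.2 - sellerCost r.1 * probShift r.2) := by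
  rw [meanGFT_valueLaw hη, buyerProb_eq, buyerGain_eq, baseGFT]; ring

/-- The buyer's price reveals something about the sign of the perturbation. -/
def exploring : Set (ℝ × ℝ) := {r | 5 / 24 < r.2 ∧ r.2 < 7 / 24}

lemma measurableSet_exploring : MeasurableSet exploring :=
  (measurableSet_lt measurable_const measurable_snd).inter
    (measurableSet_lt measurable_snd measurable_const)

open Classical in
/-- Likelihood ratio of the buyer's bit at price `q`. -/
def bitRatio (η q : ℝ) (z : Bool) : ℝ :=
  if 5 / 24 < q ∧ q < 7 / 24 then
    if z then buyerProb η q / buyerProb (-η) q else (1 - buyerProb η q) / (1 - buyerProb (-η) q)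
  else 1

lemma measurable_clamp (a b : ℝ) : Measurable (clamp a b) := by
  unfold clamp; fun_prop

lemma measurable_buyerProb (η : ℝ) : Measurable (buyerProb η) := by
  have := measurable_clamp
  unfold buyerProb; fun_prop

lemma measurable_bitRatio (η : ℝ) : Measurable fun y : ℝ × Bool => bitRatio η y.1 y.2 := by
  refine measurable_from_prod_countable_left fun z => ?_
  have h1 := measurable_buyerProb η
  have h2 := measurable_buyerProb (-η)
  refine Measurable.ite ((measurableSet_lt measurable_const measurable_id).inter
    (measurableSet_lt measurable_id measurable_const)) ?_ measurable_const
  cases z <;> simp <;> fun_prop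

lemma buyerProb_mem {η q : ℝ} (hη : |η| ≤ 1 / 100) (h1 : 5 / 24 ≤ q) (h2 : q ≤ 7 / 24) :
    1 / 2 ≤ buyerProb η q ∧ buyerProb η q ≤ 15 / 16 := by
  have hη' := abs_le.1 hη
  obtain ⟨w, y, ⟨w0, w1⟩, ⟨y0, y1⟩, hy, hG, -, -, hq⟩ := buyer_cases q
  obtain ⟨y2, y3⟩ := hq h1 h2
  obtain rfl : w = 1 / 2 := by
    rcases hy with h | h
    · linarith
    · exact h
  obtain ⟨⟨s0, s1⟩, -⟩ := shift_mem q
  rw [buyerProb_eq, hG]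
  constructor <;> nlinarith

/-- The two acceptance probabilities differ by at most `2 * η * (1 / 8)`, and `buyerProb_mem` keeps
the denominators above `1 / 16`. -/
lemma bitRatio_close {η : ℝ} (h0 : 0 ≤ η) (hη : η ≤ 1 / 100) (q : ℝ) (z : Bool) :
    |bitRatio η q z - 1| ≤ 4 * η := by
  unfold bitRatio
  split_ifs with h hz
  · have hb := buyerProb_mem (η := -η) (by rw [abs_neg, abs_of_nonneg h0]; exact hη) h.1.le h.2.le
    obtain ⟨⟨s0, s1⟩, -⟩ := shift_mem q
    have e : buyerProb η q = buyerProb (-η) q + 2 * η * probShift q := by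
      rw [buyerProb_eq, buyerProb_eq (-η)]; ring
    rw [div_sub_one (by linarith), abs_div, abs_of_pos (a := buyerProb (-η) q) (by linarith),
      div_le_iff₀ (by linarith), e, abs_of_nonneg (by nlinarith)]
    nlinarith
  · have hb := buyerProb_mem (η := -η) (by rw [abs_neg, abs_of_nonneg h0]; exact hη) h.1.le h.2.le
    obtain ⟨⟨s0, s1⟩, -⟩ := shift_mem q
    have e : buyerProb η q = buyerProb (-η) q + 2 * η * probShift q := by
      rw [buyerProb_eq, buyerProb_eq (-η)]; ring
    rw [div_sub_one (by linarith), abs_div, abs_of_pos (a := 1 - buyerProb (-η) q) (by linarith),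
      div_le_iff₀ (by linarith), e, abs_of_nonpos (by nlinarith)]
    nlinarith
  · simp [h0]

lemma bitRatio_mul {η : ℝ} (h0 : 0 ≤ η) (hη : η ≤ 1 / 100) (q : ℝ) :
    buyerProb (-η) q * bitRatio η q true = buyerProb η q ∧
    (1 - buyerProb (-η) q) * bitRatio η q false = 1 - buyerProb η q := by
  unfold bitRatio
  by_cases h : 5 / 24 < q ∧ q < 7 / 24
  · have hb := buyerProb_mem (η := -η) (by rw [abs_neg, abs_of_nonneg h0]; exact hη) h.1.le h.2.le
    simp only [h, and_self, if_true, Bool.false_eq_true, if_false]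
    exact ⟨mul_div_cancel₀ _ (by linarith), mul_div_cancel₀ _ (by linarith)⟩
  · have : probShift q = 0 := by
      rcases le_or_gt q (5 / 24) with h' | h'
      · exact (shift_of_le h').1
      · exact (shift_of_ge (not_lt.1 fun h'' => h ⟨h', h''⟩)).1
    rw [if_neg h, if_neg h, buyerProb_eq η, buyerProb_eq (-η), this]
    simp

lemma bit_change {η : ℝ} (h0 : 0 ≤ η) (hη : η ≤ 1 / 100) (q : ℝ) {G : ℝ × Bool → ℝ}
    (hG : Measurable G) (hC : ∃ C, ∀ y, |G y| ≤ C) :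
    ∫ w, G (w.1, decide (q ≤ w.2)) ∂(valueLaw η)
      = ∫ w, bitRatio η q (decide (q ≤ w.2)) * G (w.1, decide (q ≤ w.2)) ∂(valueLaw (-η)) := by
  obtain ⟨C, hC⟩ := hC
  have hη1 : |η| ≤ 1 / 100 := by rwa [abs_of_nonneg h0]
  have hm : Measurable fun y : ℝ × Bool => bitRatio η q y.2 * G y :=
    ((measurable_bitRatio η).comp (measurable_const.prodMk measurable_snd)).mul hG
  have hb (y : ℝ × Bool) : |bitRatio η q y.2 * G y| ≤ 2 * C := by
    rw [abs_mul]
    have h1 := abs_le.1 (bitRatio_close h0 hη q y.2)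
    have h2 : |bitRatio η q y.2| ≤ 2 := abs_le.2 ⟨by linarith, by linarith⟩
    exact mul_le_mul h2 (hC y) (abs_nonneg _) (by norm_num)
  rw [integral_reveal_valueLaw hη1 q hG hC,
    integral_reveal_valueLaw (G := fun y => bitRatio η q y.2 * G y) (by rwa [abs_neg]) q hm hb]
  simp only [integral_const_mul, ← mul_assoc]
  rw [(bitRatio_mul h0 hη q).1, (bitRatio_mul h0 hη q).2]

/-- The base pair of instances, for a type of feedback whose likelihood ratio is `ℓ`. -/
lemma hardPair_valueLaw {η : ℝ} (h0 : 0 ≤ η) (hη : η ≤ 1 / 100) (F : SemiFeedback)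
    (ℓ : (ℝ × ℝ) × (ℝ × Bool) → ℝ) (hm : Measurable ℓ)
    (hℓ : ∀ y, ℓ y = 1 ∨ ℓ y = bitRatio η y.1.2 y.2.2)
    (hc : ∀ (r : ℝ × ℝ) (G : ℝ × Bool → ℝ), Measurable G → (∃ C, ∀ y, |G y| ≤ C) →
      ∫ w, G (F.reveal w r) ∂(valueLaw η)
        = ∫ w, ℓ (r, F.reveal w r) * G (F.reveal w r) ∂(valueLaw (-η))) :
    HardPair F (valueLaw (-η)) (valueLaw η) exploring ℓ (1 / 4) (1 / 4 + η / 384) (1 / 400) η := by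
  have hη1 : |η| ≤ 1 / 100 := by rwa [abs_of_nonneg h0]
  have hη2 : |-η| ≤ 1 / 100 := by rwa [abs_neg]
  have hp1 := isProbabilityMeasure_buyerLaw hη1
  have hp2 := isProbabilityMeasure_buyerLaw hη2
  have houter (r : ℝ × ℝ) (hr : r ∉ exploring) : r.2 ≤ 5 / 24 ∨ 7 / 24 ≤ r.2 := by
    by_contra! h
    exact hr h
  -- Of the gap `1 / 200` the perturbation can take back at most `(1 / 100) * (1 / 8)`, which leaves
  -- more than `1 / 400`.
  have hexp (r : ℝ × ℝ) (hr : r ∈ exploring) (s : ℝ) (hs : |s| ≤ 1 / 100) :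
      meanGFT (valueLaw s) r ≤ 1 / 4 - 1 / 400 := by
    have hs' := abs_le.1 hs
    have h1 := baseGFT_le_of_explore (p := r.1) hr.1.le hr.2.le
    obtain ⟨⟨a, b⟩, c, d⟩ := shift_mem r.2
    have h2 := sellerProb_le r.1
    have h3 := sellerCost_le r.1
    have h4 : |sellerProb r.1 * gainShift r.2 - sellerCost r.1 * probShift r.2| ≤ 1 / 8 :=
      abs_le.2 ⟨by nlinarith, by nlinarith⟩
    have h5 := abs_mul s (sellerProb r.1 * gainShift r.2 - sellerCost r.1 * probShift r.2)
    have h6 := mul_le_mul hs h4 (abs_nonneg _) (by norm_num)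
    have h7 := le_abs_self (s * (sellerProb r.1 * gainShift r.2 - sellerCost r.1 * probShift r.2))
    rw [meanGFT_valueLaw_eq hs]
    linarith
  -- The price `5/6` is optimal for the downward perturbation, which does not touch its value. For
  -- the upward one it is `1/6`, where half of the sellers accept and the gain is `η * (1 / 2) * (1
  -- / 192)`.
  refine ⟨by unfold valueLaw; infer_instance, by unfold valueLaw; infer_instance,
    IndependentValues.ae_mem (valueLaw_mem hη2).1, IndependentValues.ae_mem (valueLaw_mem hη1).1,
    measurableSet_exploring, hm, fun y hy => ?_, fun y => ?_, hc, ⟨(5 / 6, 5 / 6), by norm_num, ?_⟩,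
    ⟨(1 / 6, 1 / 6), by norm_num, ?_⟩, fun r _ => ?_, fun r _ => ?_, fun r _ hr => ?_,
    fun r _ hr => ?_⟩
  · rcases hℓ y with h | h
    · exact h
    · rw [h, bitRatio]; exact if_neg hy
  · rcases hℓ y with h | h
    · simp [h, h0]
    · rw [h]; exact bitRatio_close h0 hη _ _
  · have h := shift_of_ge (q := 5 / 6) (by norm_num)
    rw [meanGFT_valueLaw_eq hη2, h.1, h.2]
    norm_num [baseGFT, sellerProb, sellerCost, buyerProb, buyerGain, clamp]
  · have h := shift_of_le (q := 1 / 6) (by norm_num)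
    rw [meanGFT_valueLaw_eq hη1, h.1, h.2]
    norm_num [baseGFT, sellerProb, sellerCost, buyerProb, buyerGain, clamp]
    ring
  · by_cases hr : r ∈ exploring
    · linarith [hexp r hr (-η) hη2]
    · have h1 := baseGFT_le r.1 r.2
      have h2 := sellerProb_le r.1
      rw [meanGFT_valueLaw_eq hη2]
      rcases houter r hr with h | h
      · rw [(shift_of_le h).1, (shift_of_le h).2]
        nlinarith
      · rw [(shift_of_ge h).1, (shift_of_ge h).2]
        linarith
  · by_cases hr : r ∈ exploring
    · linarith [hexp r hr η hη1]
    · have h1 := baseGFT_le r.1 r.2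
      have h2 := sellerProb_le r.1
      rw [meanGFT_valueLaw_eq hη1]
      rcases houter r hr with h | h
      · have h3 := baseGFT_le_of_le (p := r.1) h
        rw [(shift_of_le h).1, (shift_of_le h).2]
        -- Above `1 / 2`, each unit of seller probability costs `1 / 100` and gains only `η / 192`.
        rcases le_total (sellerProb r.1) (1 / 2) with h4 | h4 <;> nlinarith
      · rw [(shift_of_ge h).1, (shift_of_ge h).2]
        linarith
  · exact hexp r hr _ hη2
  -- The opposite perturbations cancel in the sum, so it is at most `1 / 2`, below `V₀ + V₁` by `η /
  -- 384`, which is at least `η / 400`.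
  · have h1 := baseGFT_le r.1 r.2
    rw [meanGFT_valueLaw_eq hη1, meanGFT_valueLaw_eq hη2]
    rcases houter r hr with h | h
    · rw [(shift_of_le h).1, (shift_of_le h).2]
      linarith
    · rw [(shift_of_ge h).1, (shift_of_ge h).2]
      linarith

end
end BilateralTrade

/-! ### The four types of feedback, and the reflection that exchanges the agents. -/

namespace BilateralTrade
noncomputable section

lemma measurable_bitRatio_feedback (η : ℝ) :
    Measurable fun y : (ℝ × ℝ) × (ℝ × Bool) => bitRatio η y.1.2 y.2.2 :=
  (measurable_bitRatio η).comp
    (g := fun p : ℝ × Bool => bitRatio η p.1 p.2)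
    (f := fun y : (ℝ × ℝ) × (ℝ × Bool) => (y.1.2, y.2.2)) (by fun_prop)

lemma hardPair_sellerValueBuyerBit {η : ℝ} (h0 : 0 ≤ η) (hη : η ≤ 1 / 100) :
    HardPair .sellerValueBuyerBit (valueLaw (-η)) (valueLaw η) exploring
      (fun y => bitRatio η y.1.2 y.2.2) (1 / 4) (1 / 4 + η / 384) (1 / 400) η := by
  refine hardPair_valueLaw h0 hη _ _ (measurable_bitRatio_feedback η)
    (fun y => Or.inr rfl) fun r G hG hC => ?_
  exact bit_change h0 hη r.2 hG hC

-- The trade outcome is the buyer's bit when the seller accepts and constantly false otherwise.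
-- Hence the likelihood ratio is that of the bit in the first case and `1` in the second.
open Classical in
lemma hardPair_sellerValueTrade {η : ℝ} (h0 : 0 ≤ η) (hη : η ≤ 1 / 100) :
    HardPair .sellerValueTrade (valueLaw (-η)) (valueLaw η) exploring
      (fun y => if y.2.1 ≤ y.1.1 then bitRatio η y.1.2 y.2.2 else 1)
      (1 / 4) (1 / 4 + η / 384) (1 / 400) η := by
  have hη2 : |-η| ≤ 1 / 100 := by rwa [abs_neg, abs_of_nonneg h0]
  refine hardPair_valueLaw h0 hη _ _ (Measurable.ite (measurableSet_le (by fun_prop)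
    (by fun_prop)) (measurable_bitRatio_feedback η) measurable_const)
    (fun y => ?_) fun r G hG hC => ?_
  · split_ifs
    · exact Or.inr rfl
    · exact Or.inl rfl
  · obtain ⟨C, hC⟩ := hC
    have hle : MeasurableSet {y : ℝ × Bool | y.1 ≤ r.1} :=
      measurableSet_le measurable_fst measurable_const
    have hr : Measurable fun y : ℝ × Bool => (y.1, if y.1 ≤ r.1 then y.2 else false) :=
      measurable_fst.prodMk (Measurable.ite hle measurable_snd measurable_const)
    have hrev (w : ℝ × ℝ) : SemiFeedback.sellerValueTrade.reveal w r
        = (w.1, if w.1 ≤ r.1 then decide (r.2 ≤ w.2) else false) := by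
      by_cases h : w.1 ≤ r.1 <;> simp [SemiFeedback.reveal, Trades, h]
    have hG' : Measurable fun y : ℝ × Bool => G (y.1, if y.1 ≤ r.1 then y.2 else false) :=
      hG.comp hr
    have hm : Measurable fun y : ℝ × Bool => bitRatio η r.2 y.2
        * G (y.1, if y.1 ≤ r.1 then y.2 else false) :=
      ((measurable_bitRatio η).comp (measurable_const.prodMk measurable_snd)).mul hG'
    have hm' : Measurable fun y : ℝ × Bool => (if y.1 ≤ r.1 then bitRatio η r.2 y.2 else 1)
        * G (y.1, if y.1 ≤ r.1 then y.2 else false) :=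
      (Measurable.ite hle ((measurable_bitRatio η).comp
        (measurable_const.prodMk measurable_snd)) measurable_const).mul hG'
    have hb (y : ℝ × Bool) : |bitRatio η r.2 y.2| ≤ 2 := by
      have h1 := abs_le.1 (bitRatio_close h0 hη r.2 y.2)
      exact abs_le.2 ⟨by linarith, by linarith⟩
    have hi (z : Bool) : Integrable
        (fun s => G (s, if s ≤ r.1 then z else false)) sellerLaw :=
      Integrable.of_bound (hG'.comp (measurable_prodMk_right (y := z))).aestronglyMeasurable C
        (ae_of_all _ fun _ => hC _)
    have hi' (z : Bool) : Integrable (fun s => (if s ≤ r.1 then bitRatio η r.2 z else 1)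
        * G (s, if s ≤ r.1 then z else false)) sellerLaw := by
      refine Integrable.of_bound
        (hm'.comp (measurable_prodMk_right (y := z))).aestronglyMeasurable (2 * C)
        (ae_of_all _ fun s => ?_)
      rw [norm_mul]
      refine mul_le_mul ?_ (hC _) (abs_nonneg _) (by norm_num)
      split_ifs
      · exact hb (s, z)
      · norm_num
    simp only [hrev]
    rw [bit_change h0 hη r.2 hG' ⟨C, fun y => hC _⟩,
      integral_reveal_valueLaw hη2 r.2 hm (C := 2 * C) fun y => by
        rw [abs_mul]
        exact mul_le_mul (hb y) (hC _) (abs_nonneg _) (by norm_num)]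
    have hif (w : ℝ × ℝ) : (if w.1 ≤ r.1 then bitRatio η r.2
          (if w.1 ≤ r.1 then decide (r.2 ≤ w.2) else false) else 1)
        = if w.1 ≤ r.1 then bitRatio η r.2 (decide (r.2 ≤ w.2)) else 1 := by
      split_ifs <;> rfl
    simp only [hif]
    rw [integral_reveal_valueLaw hη2 r.2 hm' (C := 2 * C) fun y => by
        rw [abs_mul]
        refine mul_le_mul ?_ (hC _) (abs_nonneg _) (by norm_num)
        split_ifs
        · exact hb y
        · norm_num]
    rw [← integral_const_mul, ← integral_const_mul, ← integral_const_mul, ← integral_const_mul,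
      ← integral_add (((hi true).const_mul _).const_mul _) (((hi false).const_mul _).const_mul _),
      ← integral_add ((hi' true).const_mul _) ((hi' false).const_mul _)]
    congr 1
    funext s
    obtain ⟨h1, h2⟩ := bitRatio_mul h0 hη r.2
    by_cases hs : s ≤ r.1
    · simp [hs]
    · simp only [hs, if_false]
      -- A refusing seller hides the bit, so only the mean of its ratio matters, and the two
      -- identities add up to total mass `1`.
      linear_combination G (s, false) * (h1 + h2)

/-- Exchange of the roles of seller and buyer. -/
def mirror (v : ℝ × ℝ) : ℝ × ℝ := (1 - v.2, 1 - v.1)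

@[fun_prop]
lemma measurable_mirror : Measurable mirror := by
  unfold mirror; fun_prop

lemma mirror_mirror (v : ℝ × ℝ) : mirror (mirror v) = v := by simp [mirror]

lemma mirror_mem {v : ℝ × ℝ} (hv : v ∈ Icc (0 : ℝ) 1 ×ˢ Icc (0 : ℝ) 1) :
    mirror v ∈ Icc (0 : ℝ) 1 ×ˢ Icc (0 : ℝ) 1 := by
  obtain ⟨⟨a, b⟩, c, d⟩ := hv
  exact ⟨⟨by simpa [mirror] using d, by simpa [mirror] using c⟩,
    by simpa [mirror] using b, by simpa [mirror] using a⟩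

lemma trades_mirror (v r : ℝ × ℝ) : Trades (mirror v) r ↔ Trades v (mirror r) := by
  unfold Trades mirror
  constructor <;> rintro ⟨h1, h2⟩ <;> dsimp only at * <;> constructor <;> linarith

lemma gft_mirror (v r : ℝ × ℝ) : gft (mirror v) r = gft v (mirror r) := by
  unfold gft
  by_cases h : Trades v (mirror r)
  · rw [if_pos h, if_pos ((trades_mirror v r).2 h)]; simp [mirror]
  · rw [if_neg h, if_neg fun h' => h ((trades_mirror v r).1 h')]

lemma meanGFT_map_mirror (D : Measure (ℝ × ℝ)) (r : ℝ × ℝ) :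
    meanGFT (D.map mirror) r = meanGFT D (mirror r) := by
  have hg : Measurable fun v : ℝ × ℝ => gft v r :=
    measurable_gft.comp (measurable_id.prodMk measurable_const)
  rw [meanGFT, integral_map measurable_mirror.aemeasurable hg.aestronglyMeasurable]
  simp only [gft_mirror, meanGFT]

/-- Feedback as seen after exchanging the roles of seller and buyer. -/
def mirrorFeedback (y : ℝ × Bool) : ℝ × Bool := (1 - y.1, y.2)

lemma measurable_mirrorFeedback : Measurable mirrorFeedback := by
  unfold mirrorFeedback; fun_prop

lemma mirrorFeedback_mirrorFeedback (y : ℝ × Bool) : mirrorFeedback (mirrorFeedback y) = y := by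
  simp [mirrorFeedback]

/-- `mirror` is an involution that preserves the gains from trade, the unit square and the order `p
≤ q`. Every condition therefore transfers once `hF` matches the two types of feedback. -/
lemma HardPair.map_mirror {F F' : SemiFeedback} {D₀ D₁ : Measure (ℝ × ℝ)} {E : Set (ℝ × ℝ)}
    {ℓ : (ℝ × ℝ) × (ℝ × Bool) → ℝ} {V₀ V₁ c η : ℝ} (H : HardPair F D₀ D₁ E ℓ V₀ V₁ c η)
    (hF : ∀ v r, F'.reveal (mirror v) r = mirrorFeedback (F.reveal v (mirror r))) :
    HardPair F' (D₀.map mirror) (D₁.map mirror) (mirror ⁻¹' E)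
      (fun y => ℓ (mirror y.1, mirrorFeedback y.2)) V₀ V₁ c η := by
  have := H.prob₀
  have := H.prob₁
  have hsupp (D : Measure (ℝ × ℝ)) (hD : ∀ᵐ v ∂D, v ∈ Icc (0 : ℝ) 1 ×ˢ Icc (0 : ℝ) 1) :
      ∀ᵐ v ∂(D.map mirror), v ∈ Icc (0 : ℝ) 1 ×ˢ Icc (0 : ℝ) 1 := by
    refine (ae_map_iff measurable_mirror.aemeasurable
      (measurableSet_Icc.prod measurableSet_Icc)).2 ?_
    exact hD.mono fun v hv => mirror_mem hv
  have hatt {D : Measure (ℝ × ℝ)} {V : ℝ}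
      (h : ∃ r : ℝ × ℝ, (0 ≤ r.1 ∧ r.1 ≤ r.2 ∧ r.2 ≤ 1) ∧ meanGFT D r = V) :
      ∃ r : ℝ × ℝ, (0 ≤ r.1 ∧ r.1 ≤ r.2 ∧ r.2 ≤ 1) ∧ meanGFT (D.map mirror) r = V := by
    obtain ⟨r, ⟨h1, h2, h3⟩, h⟩ := h
    refine ⟨mirror r, ⟨?_, ?_, ?_⟩, by rw [meanGFT_map_mirror, mirror_mirror, h]⟩ <;>
      simp only [mirror] <;> linarith
  have hmℓ : Measurable fun y : (ℝ × ℝ) × (ℝ × Bool) => ℓ (mirror y.1, mirrorFeedback y.2) :=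
    H.measurable_ratio.comp ((measurable_mirror.comp measurable_fst).prodMk
      (measurable_mirrorFeedback.comp measurable_snd))
  have hrev (r : ℝ × ℝ) : Measurable fun v => F'.reveal v r :=
    F'.measurable_reveal.comp (measurable_id.prodMk measurable_const)
  refine ⟨Measure.isProbabilityMeasure_map measurable_mirror.aemeasurable,
    Measure.isProbabilityMeasure_map measurable_mirror.aemeasurable, hsupp _ H.supp₀,
    hsupp _ H.supp₁, measurable_mirror H.measurable_explore, hmℓ,
    fun y hy => H.ratio_off _ hy, fun y => H.ratio_close _, fun r G hG hC => ?_,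
    hatt H.attained₀, hatt H.attained₁, fun r hr => ?_, fun r hr => ?_, fun r hr hE => ?_,
    fun r hr hE => ?_⟩
  · obtain ⟨C, hC⟩ := hC
    have hm1 : Measurable fun v => G (F'.reveal v r) := hG.comp (hrev r)
    have hm2 : Measurable fun v => ℓ (mirror r, mirrorFeedback (F'.reveal v r))
        * G (F'.reveal v r) :=
      (hmℓ.comp (measurable_const.prodMk (hrev r))).mul hm1
    rw [integral_map measurable_mirror.aemeasurable hm1.aestronglyMeasurable,
      integral_map measurable_mirror.aemeasurable hm2.aestronglyMeasurable]
    simp only [hF, mirrorFeedback_mirrorFeedback]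
    exact H.change (mirror r) (fun y => G (mirrorFeedback y)) (hG.comp measurable_mirrorFeedback)
      ⟨C, fun y => hC _⟩
  · rw [meanGFT_map_mirror]; exact H.le₀ _ (mirror_mem hr)
  · rw [meanGFT_map_mirror]; exact H.le₁ _ (mirror_mem hr)
  · rw [meanGFT_map_mirror]; exact H.explore _ (mirror_mem hr) hE
  · rw [meanGFT_map_mirror, meanGFT_map_mirror]; exact H.exploit _ (mirror_mem hr) hE

lemma measurePreserving_mirror : MeasurePreserving mirror := by
  have h1 : MeasurePreserving (fun x : ℝ => 1 - x) := Measure.measurePreserving_sub_left volume 1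
  exact (h1.prod h1).comp Measure.measurePreserving_swap

lemma IndependentValues.map_mirror {D : Measure (ℝ × ℝ)} (hD : D ∈ IndependentValues) :
    D.map mirror ∈ IndependentValues := by
  obtain ⟨S, B, hS, hB, hS0, hB0, rfl⟩ := hD
  have hm : Measurable fun x : ℝ => 1 - x := by fun_prop
  have hc (m : Measure ℝ) (h : m (Icc 0 1)ᶜ = 0) : m.map (fun x => 1 - x) (Icc 0 1)ᶜ = 0 := by
    rw [Measure.map_apply hm measurableSet_Icc.compl]
    convert h using 2
    ext x
    simp only [mem_preimage, mem_compl_iff, mem_Icc]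
    constructor <;> intro h h' <;> apply h <;> constructor <;> linarith [h'.1, h'.2]
  refine ⟨B.map fun x => 1 - x, S.map fun x => 1 - x,
    Measure.isProbabilityMeasure_map hm.aemeasurable,
    Measure.isProbabilityMeasure_map hm.aemeasurable, hc B hB0, hc S hS0, ?_⟩
  rw [Measure.map_prod_map _ _ hm hm, ← Measure.prod_swap (μ := B) (ν := S),
    Measure.map_map measurable_mirror measurable_swap]
  rfl

lemma DensityBounded.map_mirror {K : NNReal} {D : Measure (ℝ × ℝ)} (hD : D ∈ DensityBounded K) :
    D.map mirror ∈ DensityBounded K := by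
  obtain ⟨f, hf, hK, rfl⟩ := hD
  refine ⟨fun v => f (mirror v), hf.comp measurable_mirror, fun v => hK _, ?_⟩
  ext s hs
  have e := measurePreserving_mirror.setLIntegral_comp_preimage hs (hf.comp measurable_mirror)
  simp only [Function.comp_apply, mirror_mirror] at e
  rw [Measure.map_apply measurable_mirror hs, withDensity_apply _ (measurable_mirror hs),
    withDensity_apply _ hs, e]

lemma exists_hardPair {η : ℝ} (h0 : 0 ≤ η) (hη : η ≤ 1 / 100) (F : SemiFeedback) :
    ∃ D₀ ∈ IndependentValues ∩ DensityBounded 11, ∃ D₁ ∈ IndependentValues ∩ DensityBounded 11,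
      ∃ E ℓ V₀ V₁, HardPair F D₀ D₁ E ℓ V₀ V₁ (1 / 400) η := by
  have m₁ : valueLaw η ∈ IndependentValues ∩ DensityBounded 11 :=
    valueLaw_mem (by rwa [abs_of_nonneg h0])
  have m₀ : valueLaw (-η) ∈ IndependentValues ∩ DensityBounded 11 :=
    valueLaw_mem (by rwa [abs_neg, abs_of_nonneg h0])
  have m₁' : (valueLaw η).map mirror ∈ IndependentValues ∩ DensityBounded 11 :=
    ⟨IndependentValues.map_mirror m₁.1, DensityBounded.map_mirror m₁.2⟩
  have m₀' : (valueLaw (-η)).map mirror ∈ IndependentValues ∩ DensityBounded 11 :=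
    ⟨IndependentValues.map_mirror m₀.1, DensityBounded.map_mirror m₀.2⟩
  cases F
  · exact ⟨_, m₀, _, m₁, _, _, _, _, hardPair_sellerValueBuyerBit h0 hη⟩
  · refine ⟨_, m₀', _, m₁', _, _, _, _,
      (hardPair_sellerValueBuyerBit h0 hη).map_mirror fun v r => ?_⟩
    have : 1 - v.2 ≤ r.1 ↔ 1 - r.1 ≤ v.2 := by constructor <;> intro <;> linarith
    simp [SemiFeedback.reveal, mirror, mirrorFeedback, this]
  · exact ⟨_, m₀, _, m₁, _, _, _, _, hardPair_sellerValueTrade h0 hη⟩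
  · refine ⟨_, m₀', _, m₁', _, _, _, _,
      (hardPair_sellerValueTrade h0 hη).map_mirror fun v r => ?_⟩
    simp only [SemiFeedback.reveal, mirrorFeedback, trades_mirror]
    rfl

/-! ### Choice of the perturbation and conclusion. -/

lemma Mechanism.le_worstRegret {T : ℕ} (hT : 40000 ≤ T) {Ω : Type*} [MeasurableSpace Ω]
    (M : Mechanism T Ω) (F : SemiFeedback) {𝒟 : Set (Measure (ℝ × ℝ))}
    (h𝒟 : IndependentValues ∩ DensityBounded 11 ⊆ 𝒟) :
    ((1 / 5000 * (T : ℝ) ^ (2 / 3 : ℝ) : ℝ) : EReal) ≤ M.worstRegret F 𝒟 := by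
  have hT' : (40000 : ℝ) ≤ T := by exact_mod_cast hT
  set x : ℝ := (T : ℝ) ^ (1 / 3 : ℝ) with hx
  have hx0 : 0 < x := Real.rpow_pos_of_pos (by linarith) _
  have hx3 : x ^ 3 = T := by
    rw [hx, ← Real.rpow_natCast, ← Real.rpow_mul (by linarith)]; norm_num
  have hx2 : (T : ℝ) ^ (2 / 3 : ℝ) = x ^ 2 := by
    rw [hx, ← Real.rpow_natCast, ← Real.rpow_mul (by linarith)]; norm_num
  -- This is what `1 / (3 * x) ≤ 1 / 100` requires; `(100 / 3) ^ 3` is about `37037`, below `40000`.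
  have hx100 : 100 / 3 ≤ x := by
    by_contra! h
    have : x ^ 3 < (100 / 3) ^ 3 := pow_lt_pow_left₀ h hx0.le (by norm_num)
    norm_num at this
    linarith
  -- The factor `3` gives `16 * η ^ 3 * T = 16 / 27`, which leaves room for `η` in the condition of
  -- `le_regret_add`.
  obtain ⟨D₀, m₀, D₁, m₁, E, ℓ, V₀, V₁, H⟩ := exists_hardPair (η := 1 / (3 * x)) (by positivity)
    (by rw [div_le_div_iff₀ (by positivity) (by norm_num)]; linarith) F
  have hη : 1 / (3 * x) ≤ 1 / 100 := by
    rw [div_le_div_iff₀ (by positivity) (by norm_num)]; linarith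
  have key := H.le_regret_add M (by positivity) hη (by norm_num) (by
    have : 16 * (1 / (3 * x)) ^ 3 * T = 16 / 27 := by
      rw [← hx3]; field_simp; norm_num
    rw [this]; linarith)
  have e : 1 / 400 * (1 / (3 * x)) * T / 2 = 1 / 2400 * x ^ 2 := by
    rw [← hx3]; field_simp; norm_num
  rw [e] at key
  rw [hx2]
  have hle (D : Measure (ℝ × ℝ)) (hD : D ∈ IndependentValues ∩ DensityBounded 11)
      (h : 1 / 5000 * x ^ 2 ≤ M.regret F D) :
      ((1 / 5000 * x ^ 2 : ℝ) : EReal) ≤ M.worstRegret F 𝒟 :=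
    le_iSup₂_of_le D (h𝒟 hD) (EReal.coe_le_coe_iff.2 h)
  -- The two regrets sum to at least `x ^ 2 / 2400`, so one of them is at least `x ^ 2 / 4800`, more
  -- than `x ^ 2 / 5000`.
  by_contra! hcon
  have c₀ := fun h => hcon.not_ge (hle D₀ m₀ h)
  have c₁ := fun h => hcon.not_ge (hle D₁ m₁ h)
  nlinarith [not_le.1 c₀, not_le.1 c₁]

end
end BilateralTrade

theorem theorem4p1 :
    ∃ c : ℝ, 0 < c ∧ ∃ T₀ : ℕ, ∀ T : ℕ, T₀ ≤ T →
      ∀ (Ω : Type*) [MeasurableSpace Ω] (M : BilateralTrade.Mechanism T Ω)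
        (F : BilateralTrade.SemiFeedback),
        (M.IsGBB F BilateralTrade.IndependentValues →
          ((c * (T : ℝ) ^ (2 / 3 : ℝ) : ℝ) : EReal) ≤
            M.worstRegret F BilateralTrade.IndependentValues) ∧
        (M.IsGBB F (BilateralTrade.IndependentValues ∩ BilateralTrade.DensityBounded 11) →
          ((c * (T : ℝ) ^ (2 / 3 : ℝ) : ℝ) : EReal) ≤
            M.worstRegret F
              (BilateralTrade.IndependentValues ∩ BilateralTrade.DensityBounded 11)) :=
  ⟨1 / 5000, by norm_num, 40000, fun _ hT _ _ M F =>
    ⟨fun _ => M.le_worstRegret hT F inter_subset_left, fun _ => M.le_worstRegret hT F subset_rfl⟩⟩
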